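/- **Conventions.** Filtrations are indexed by the non-positive integers (or, for triples, by $0,1,2$), and all sub-$\sigma$-fields are completed by the null events of the ambient probability space. Random variables are uniform on a finite set $F$ if their law is the uniform probability on $F$. The natural filtration $\mathcal F^X$ of a process $X$ is given by $\mathcal F^X_n=\sigma(X_k : k\le n)$. A filtration $\mathcal F$ is *immersed* into $\mathcal G$ (on the same probability space) if $\mathcal F_n\subset\mathcal G_n$ for every $n$ and, for every $n$ for which the time $n-1$ exists, $\mathcal F_n$ and $\mathcal G_{n-1}$ are independent conditionally on $\mathcal F_{n-1}$. A filtration is *of product type* if it is the natural filtration of a sequence of independent (real) random variables. An *isomorphism* from $(\Omega,\mathbb P,\mathcal F)$ to $(\Omega',\mathbb P',\mathcal F')$ is a bijection $\Psi$ from $L^0(\Omega,\mathcal F_\infty,\mathbb P)$ to $L^0(\Omega',\mathcal F'_\infty,\mathbb P')$ (spaces of real random variables modulo almost sure equality, $\mathcal F_\infty$ being generated by all the $\mathcal F_n$) that preserves laws, commutes with Borel functions $\mathbb R^{\mathbb N}\to\mathbb R$ of sequences of random variables, and is such that, for every $n$, the variables $\Psi(Y)$ with $Y\in L^0(\Omega,\mathcal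 F_n,\mathbb P)$ generate $\mathcal F'_n$. A filtration $\mathcal F$ is *standard* if, on some probability space, there is a filtration $\mathcal F'$ isomorphic to $\mathcal F$ which is immersed into some product-type filtration. A *non-anticipative coupling* of two copies of a process $Z$ is a pair of processes $Z',Z''$, defined on one probability space $(\bar\Omega,\bar{\mathcal A},\bar{\mathbb P})$, each having the law of $Z$, such that the natural filtrations of $Z'$ and of $Z''$ are both immersed into the natural filtration of $(Z',Z'')$. For $\alpha\in\,]0,1[$, a triple $(Z_0,Z_1,Z_2)$ of uniform random variables on finite sets is a *Tsirelson $\alpha$-brick* if it is Markov, if $Z_0$ and $Z_2$ are independent, and if for every non-anticipative coupling $(Z'_0,Z'_1,Z'_2)$, $(Z''_0,Z''_1,Z''_2)$ of two copies of it, $$\bar{\mathbb P}\big[Z'_2\ne Z''_2\,\big|\,\sigma(Z'_0,Z''_0)\big]\ge 1-\alpha\quad\text{almost surely on the event }[Z'_0\ne Z''_0].$$ **Theorem (Tsirelson's construction).** Let $(X_n)_{n\le 0}$ be a sequence of uniform random variables with values in finite sets $(F_n)_{n\le 0}$, defined on one probability space, and let $(\alpha_n)_{n\le 0}$ be a $]0,1[$-valued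 sequence such that $\sum_{n\le0}\alpha_n<+\infty$. Assume that - for every $n\le 0$, the set $F_{2n}$ is not a singleton; - $(X_n)_{n\le 0}$ is a (not necessarily homogeneous) Markov process; - for every $n\le 0$, the triple $(X_{2n-2},X_{2n-1},X_{2n})$ is a Tsirelson $\alpha_n$-brick. Then the natural filtration $\mathcal F^X$ is not standard. Moreover, if the tail $\sigma$-field $\mathcal F^X_{-\infty}=\bigcap_{n\le 0}\mathcal F^X_n$ is trivial (all its events have probability $0$ or $1$), then $|F_{2n}|\to+\infty$ as $n\to-\infty$. -/

import Mathlib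

open MeasureTheory ProbabilityTheory Filter

universe u v w

/-- The time set: the non-positive integers. -/
abbrev NonposInt : Type := {n : ℤ // n ≤ 0}

section SigmaFields

variable {Ω : Type*} {mΩ : MeasurableSpace Ω}

/-- The completion of a sub-σ-field `m`: all events (measurable sets of `Ω`) that agree with
an event of `m` up to a `μ`-null set. -/
@[reducible]
def completion (μ : Measure Ω) (m : MeasurableSpace Ω) : MeasurableSpace Ω :=
  eventuallyMeasurableSpace m (ae μ) ⊓ mΩ

/-- Events of the completion: measurable sets which are a.e. equal to an event of `m`. -/
theorem measurableSet_completion_iff {μ : Measure Ω} {m : MeasurableSpace Ω} {s : Set Ω} :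
    MeasurableSet[completion μ m] s ↔
      (∃ t, MeasurableSet[m] t ∧ s =ᵐ[μ] t) ∧ MeasurableSet[mΩ] s :=
  MeasurableSpace.measurableSet_inf

/-- The completion is monotone. -/
theorem completion_mono (μ : Measure Ω) {m₁ m₂ : MeasurableSpace Ω} (h : m₁ ≤ m₂) :
    completion μ m₁ ≤ completion μ m₂ := by
  intro s hs
  rw [measurableSet_completion_iff] at hs ⊢
  obtain ⟨⟨t, ht, hst⟩, hs'⟩ := hs
  exact ⟨⟨t, h t ht, hst⟩, hs'⟩

/-- `m₁` and `m₂` are independent conditionally on `m` (without any assumption on the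
measurable space `Ω`). -/
def CondIndepSigma (μ : Measure Ω) (m m₁ m₂ : MeasurableSpace Ω) : Prop :=
  ∀ s t : Set Ω, MeasurableSet[m₁] s → MeasurableSet[m₂] t →
    μ⟦s ∩ t | m⟧ =ᵐ[μ] μ⟦s | m⟧ * μ⟦t | m⟧

/-- The σ-field `m` is trivial: all its events have probability `0` or `1`. -/
def IsTrivialSigma (μ : Measure Ω) (m : MeasurableSpace Ω) : Prop :=
  ∀ s : Set Ω, MeasurableSet[m] s → μ s = 0 ∨ μ s = 1

/-- The set `L⁰(Ω, m, μ)` of (classes modulo `μ` of) real random variables that are measurable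
with respect to `m`, up to null sets. -/
def L0 (μ : Measure Ω) : MeasurableSpace Ω → Set (Ω →ₘ[μ] ℝ) :=
  fun m => {f | AEStronglyMeasurable[m] (@AEEqFun.cast Ω ℝ mΩ μ _ f) μ}

end SigmaFields

section Filtrations

variable {ι : Type*} [Preorder ι]

/-- The natural filtration of a process `X`: at time `i`, the complete σ-field generated by
the `X j` with `j ≤ i`. -/
def naturalFiltration {Ω : Type*} {mΩ : MeasurableSpace Ω} (μ : Measure Ω) {E : ι → Type*}
    [∀ i, MeasurableSpace (E i)] (X : (i : ι) → Ω → E i) : Filtration ι mΩ where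
  seq i := completion μ (⨆ j ≤ i, MeasurableSpace.comap (X j) inferInstance)
  mono' _ _ hij := completion_mono μ (biSup_mono fun _ h => h.trans hij)
  le' _ := inf_le_right

/-- `F` is immersed into `G`: for every `j` with immediate predecessor `i`, `F j` and `G i` are
independent conditionally on `F i`, and `F j ⊆ G j` for all `j`. -/
def Immersed {Ω : Type*} {mΩ : MeasurableSpace Ω} (μ : Measure Ω) (F G : Filtration ι mΩ) :
    Prop :=
  (∀ j, F j ≤ G j) ∧ ∀ i j, i ⋖ j → CondIndepSigma μ (F i) (F j) (G i)

/-- An isomorphism of filtered probability spaces from `(Ω, μ, F)` to `(Ω', μ', F')`: a bijection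
from `L⁰(Ω, F_∞, μ)` to `L⁰(Ω', F'_∞, μ')` that preserves the laws, commutes with Borel
operations and sends `F` to `F'`. -/
structure FilteredIso {Ω Ω' : Type*} {mΩ : MeasurableSpace Ω} {mΩ' : MeasurableSpace Ω'}
    (μ : Measure Ω) (F : Filtration ι mΩ) (μ' : Measure Ω') (F' : Filtration ι mΩ') where
  /-- the bijection -/
  toEquiv : L0 μ (⨆ i, F i) ≃ L0 μ' (⨆ i, F' i)
  law_eq : ∀ Y, μ'.map ((toEquiv Y : Ω' →ₘ[μ'] ℝ) : Ω' → ℝ) = μ.map ((Y : Ω →ₘ[μ] ℝ) : Ω → ℝ)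
  comm_borel : ∀ (Y : ℕ → L0 μ (⨆ i, F i)) (Φ : (ℕ → ℝ) → ℝ), Measurable Φ →
    ∀ Z : L0 μ (⨆ i, F i),
      ((Z : Ω →ₘ[μ] ℝ) : Ω → ℝ) =ᵐ[μ] (fun ω => Φ fun k => (Y k : Ω →ₘ[μ] ℝ) ω) →
      ((toEquiv Z : Ω' →ₘ[μ'] ℝ) : Ω' → ℝ) =ᵐ[μ']
        (fun ω => Φ fun k => (toEquiv (Y k) : Ω' →ₘ[μ'] ℝ) ω)
  /-- For each `i`, the images of the `F i`-measurable random variables generate `F' i`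
  (as complete σ-fields). -/
  generate : ∀ i, completion μ' (⨆ (Y : L0 μ (⨆ i, F i)) (_ : (Y : Ω →ₘ[μ] ℝ) ∈ L0 μ (F i)),
      MeasurableSpace.comap ((toEquiv Y : Ω' →ₘ[μ'] ℝ) : Ω' → ℝ) inferInstance) = completion μ' (F' i)

/-- A filtration is of product type if it is the natural filtration of a family of independent
real random variables. -/
def IsProductType {Ω : Type*} {mΩ : MeasurableSpace Ω} (μ : Measure Ω) (G : Filtration ι mΩ) :
    Prop :=
  ∃ V : ι → Ω → ℝ, (∀ i, Measurable (V i)) ∧ iIndepFun V μ ∧ G = naturalFiltration μ V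

/-- A filtration `F` is standard if it is immersible into a product-type filtration: on some
probability space there are a product-type filtration `G'` and a filtration `F'` isomorphic
to `F` which is immersed into `G'`. The second universe is the one of the new space. -/
def IsStandard {Ω : Type u} {mΩ : MeasurableSpace Ω} (μ : Measure Ω) (F : Filtration ι mΩ) :
    Prop :=
  ∃ (Ω' : Type v) (mΩ' : MeasurableSpace Ω') (μ' : Measure Ω') (F' G' : Filtration ι mΩ'),
    IsProbabilityMeasure μ' ∧ Nonempty (FilteredIso μ F μ' F') ∧ IsProductType μ' G' ∧
      Immersed μ' F' G'

/-- `X` is a (not necessarily homogeneous) Markov process: for every `j` with immediate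
predecessor `i`, the conditional law of `X j` given the past up to `i` is its conditional law
given `X i`. -/
def IsMarkov {Ω : Type*} {mΩ : MeasurableSpace Ω} (μ : Measure Ω) {E : ι → Type*}
    [∀ i, MeasurableSpace (E i)] (X : (i : ι) → Ω → E i) : Prop :=
  ∀ i j, i ⋖ j → ∀ s : Set (E j), MeasurableSet s →
    μ⟦X j ⁻¹' s | naturalFiltration μ X i⟧ =ᵐ[μ]
      μ⟦X j ⁻¹' s | MeasurableSpace.comap (X i) inferInstance⟧

/-- The processes `X'` and `X''`, defined on the same probability space `(Ω', P)`, form a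
non-anticipative coupling of two copies of the process `X`: both have the law of `X`, and their
natural filtrations are immersed into the natural filtration of `(X', X'')`. -/
structure IsNonAnticipativeCoupling {Ω Ω' : Type*} {mΩ : MeasurableSpace Ω}
    {mΩ' : MeasurableSpace Ω'} (μ : Measure Ω) {E : ι → Type*} [∀ i, MeasurableSpace (E i)]
    (X : (i : ι) → Ω → E i) (P : Measure Ω') (X' X'' : (i : ι) → Ω' → E i) : Prop where
  measurable_left : ∀ i, Measurable (X' i)
  measurable_right : ∀ i, Measurable (X'' i)
  law_left : P.map (fun ω i => X' i ω) = μ.map (fun ω i => X i ω)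
  law_right : P.map (fun ω i => X'' i ω) = μ.map (fun ω i => X i ω)
  immersed_left : Immersed P (naturalFiltration P X')
    (naturalFiltration P fun i ω => (X' i ω, X'' i ω))
  immersed_right : Immersed P (naturalFiltration P X'')
    (naturalFiltration P fun i ω => (X' i ω, X'' i ω))

end Filtrations

/-- `X` is a random variable which is uniformly distributed on the finite set `E`. -/
def IsUniformRV {Ω : Type*} {mΩ : MeasurableSpace Ω} (μ : Measure Ω) {E : Type*}
    [MeasurableSpace E] (X : Ω → E) : Prop :=
  Measurable X ∧ μ.map X = uniformOn Set.univ

/-- A triple `Z = (Z 0, Z 1, Z 2)` of uniform random variables with values in the finite sets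
`E 0`, `E 1`, `E 2` is a Tsirelson `α`-brick. (As the variables take finitely many values, it
makes no difference in which universe the spaces carrying the couplings live.) -/
structure IsTsirelsonBrick {Ω : Type*} {mΩ : MeasurableSpace Ω} (μ : Measure Ω)
    {E : Fin 3 → Type*} [∀ k, Fintype (E k)] [∀ k, MeasurableSpace (E k)] (α : ℝ)
    (Z : (k : Fin 3) → Ω → E k) : Prop where
  uniform : ∀ k, IsUniformRV μ (Z k)
  markov : IsMarkov μ Z
  indep : IndepFun (Z 0) (Z 2) μ
  coupling : ∀ (Ω' : Type) (_ : MeasurableSpace Ω') (P : Measure Ω'), IsProbabilityMeasure P →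
    ∀ Z' Z'' : (k : Fin 3) → Ω' → E k, IsNonAnticipativeCoupling μ Z P Z' Z'' →
      ∀ᵐ ω ∂P, Z' 0 ω ≠ Z'' 0 ω →
        1 - α ≤ (P⟦{ω' | Z' 2 ω' ≠ Z'' 2 ω'} |
          MeasurableSpace.comap (fun ω' => (Z' 0 ω', Z'' 0 ω')) inferInstance⟧) ω

/-- The time `2n`, for `n ≤ 0`. -/
def NonposInt.double (n : NonposInt) : NonposInt := ⟨2 * n.1, by have := n.2; omega⟩

/-- The times `2n - 2`, `2n - 1`, `2n` (for `k = 0, 1, 2`), for `n ≤ 0`. -/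
def NonposInt.brickTime (n : NonposInt) (k : Fin 3) : NonposInt :=
  ⟨2 * n.1 - 2 + (k : ℕ), by have := n.2; have := k.2; omega⟩

/-! If the filtration were standard, the process could be written as an adapted function `f` of
independent real coordinates, with unchanged law and with unchanged transitions relative to the
coordinate filtration (`IsStandard.exists_representation`). Take two independent families of
coordinates and replace those up to time `m` in the first family by those of the second
(`swapBelow`). Evaluating `f` on the first family and on the mixed one gives two copies of the
process that are independent up to time `m` and driven by the same noise afterwards.

Both copies are Markov with the original transitions in the filtration of the pair of families, so
each brick carries a non-anticipative coupling. Hence crossing the brick ending at `2n` multiplies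
the probability of disagreement by at least `1 - α n` (`IsTsirelsonBrick.le_measureReal_inter`). At
an even time `m` the copies are independent and uniform on at least two points, so they differ with
probability at least `1/2`. Since the infinite product of the `1 - α n` is positive
(`exists_pos_le_prod_one_sub`), the probability of disagreement at time `0` stays bounded below as
`m → -∞`. But `f` at time `0` is almost a function of finitely many coordinates, which mixing in the
remote past does not touch, so this probability tends to `0`
(`eventually_measure_preimage_diff_lt`): a contradiction.

For the cardinalities, two independent copies of a brick form a non-anticipative coupling.
Conditionally on distinct initial values their final values are independent and uniform, hence agree
with probability `1 / |F_{2n}|`. The brick inequality gives `1 / |F_{2n}| ≤ α n`, which tends to `0`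
(`IsTsirelsonBrick.inv_card_le`).

Transition probabilities are handled through `HasCondProb`, an identity between measures of events
that passes easily to smaller σ-fields, completions, images and products, and across the
isomorphism. -/

open scoped NNReal ENNReal

/-! ### Conditional probabilities that are constant on an event -/

section CondProb

variable {Ω : Type*}

/-- On the event `s`, the conditional probability of `u` given the σ-field `H` is `p`. -/
def HasCondProb {_m : MeasurableSpace Ω} (P : Measure Ω) (H : MeasurableSpace Ω)
    (s u : Set Ω) (p : ℝ≥0) : Prop :=
  ∀ t, MeasurableSet[H] t → P (t ∩ s ∩ u) = p * P (t ∩ s)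

theorem HasCondProb.mono {H H' _mΩ : MeasurableSpace Ω} {P : Measure Ω} {s u : Set Ω} {p : ℝ≥0}
    (h : HasCondProb P H s u p) (hH : H' ≤ H) : HasCondProb P H' s u p :=
  fun t ht => h t (hH t ht)

theorem HasCondProb.congr {H mΩ : MeasurableSpace Ω} {P : Measure Ω} {s u s' u' : Set Ω} {p : ℝ≥0}
    (h : HasCondProb P H s u p) (hs : s =ᵐ[P] s') (hu : u =ᵐ[P] u') :
    HasCondProb P H s' u' p := by
  intro t ht
  have h1 : (t ∩ s : Set Ω) =ᵐ[P] (t ∩ s' : Set Ω) := (ae_eq_refl t).inter hs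
  rw [← measure_congr h1, ← measure_congr (h1.inter hu)]
  exact h t ht

theorem HasCondProb.completion {H mΩ : MeasurableSpace Ω} {P : Measure Ω} {s u : Set Ω} {p : ℝ≥0}
    (h : HasCondProb P H s u p) : HasCondProb P (completion P H) s u p := by
  intro t ht
  obtain ⟨⟨t', ht', htt'⟩, -⟩ := measurableSet_completion_iff.1 ht
  have h1 : (t ∩ s : Set Ω) =ᵐ[P] (t' ∩ s : Set Ω) := htt'.inter (ae_eq_refl s)
  rw [measure_congr h1, measure_congr (h1.inter (ae_eq_refl u))]
  exact h t' ht'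

theorem HasCondProb.map {Ω' : Type*} {H mΩ : MeasurableSpace Ω} {H' mΩ' : MeasurableSpace Ω'}
    {P : Measure Ω} {φ : Ω → Ω'} (hφ : Measurable φ) {s u : Set Ω'}
    {p : ℝ≥0} (h : HasCondProb P H (φ ⁻¹' s) (φ ⁻¹' u) p) (hH : H' ≤ mΩ')
    (hs : MeasurableSet s) (hu : MeasurableSet u)
    (hH' : ∀ t, MeasurableSet[H'] t → MeasurableSet[H] (φ ⁻¹' t)) :
    HasCondProb (P.map φ) H' s u p := by
  intro t ht
  rw [Measure.map_apply hφ ((hH t ht).inter hs),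
    Measure.map_apply hφ (((hH t ht).inter hs).inter hu)]
  exact h _ (hH' t ht)

/-- Both sides of the defining identity are finite measures in `t`, so it suffices to compare them
on a π-system and on the whole space. -/
theorem HasCondProb.of_isPiSystem {H mΩ : MeasurableSpace Ω} {P : Measure Ω} [IsFiniteMeasure P]
    (hH : H ≤ mΩ) {s u : Set Ω} {p : ℝ≥0}
    {C : Set (Set Ω)} (hC : IsPiSystem C) (hgen : H = MeasurableSpace.generateFrom C)
    (huniv : P (s ∩ u) = p * P s) (h : ∀ t ∈ C, P (t ∩ s ∩ u) = p * P (t ∩ s)) :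
    HasCondProb P H s u p := by
  have key : ((P.restrict (s ∩ u)).trim hH) = (p • P.restrict s).trim hH := by
    refine ext_of_generate_finite C hgen hC (fun t ht => ?_) ?_
    · have htH : MeasurableSet[H] t := by
        rw [hgen]; exact MeasurableSpace.measurableSet_generateFrom ht
      rw [trim_measurableSet_eq hH htH, trim_measurableSet_eq hH htH, Measure.smul_apply,
        Measure.restrict_apply (hH t htH), Measure.restrict_apply (hH t htH), ← Set.inter_assoc]
      exact h t ht
    · rw [trim_measurableSet_eq hH .univ, trim_measurableSet_eq hH .univ, Measure.smul_apply,
        Measure.restrict_apply .univ, Measure.restrict_apply .univ, Set.univ_inter,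
        Set.univ_inter]
      exact huniv
  intro t ht
  have := congrArg (fun ν : @Measure Ω H => ν t) key
  rw [trim_measurableSet_eq hH ht, trim_measurableSet_eq hH ht, Measure.smul_apply,
        Measure.restrict_apply (hH t ht), Measure.restrict_apply (hH t ht), ← Set.inter_assoc]
    at this
  exact this

theorem HasCondProb.condExp_eq {H mΩ : MeasurableSpace Ω} {P : Measure Ω} [IsFiniteMeasure P]
    (hH : H ≤ mΩ) {s u : Set Ω} (hs : MeasurableSet[H] s) (hu : MeasurableSet u) {p : ℝ≥0}
    (h : HasCondProb P H s u p) :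
    s.indicator (P⟦u | H⟧) =ᵐ[P] s.indicator fun _ => (p : ℝ) := by
  have hint : Integrable (u.indicator fun _ => (1 : ℝ)) P :=
    (integrable_const 1).indicator hu
  refine (condExp_indicator hint hs).symm.trans ?_
  refine (ae_eq_condExp_of_forall_setIntegral_eq hH (hint.indicator (hH s hs)) ?_ ?_ ?_).symm
  · exact fun _ _ _ => ((integrable_const _).indicator (hH s hs)).integrableOn
  · intro t ht _
    rw [Set.indicator_indicator, setIntegral_indicator (hH s hs),
      setIntegral_indicator ((hH s hs).inter hu), ← Set.inter_assoc]
    simp [Measure.real, h t ht, mul_comm]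
  · exact (stronglyMeasurable_const.indicator hs).aestronglyMeasurable

theorem setIntegral_condProb {H mΩ : MeasurableSpace Ω} {P : Measure Ω} [IsFiniteMeasure P]
    (hH : H ≤ mΩ) {s u : Set Ω} (hs : MeasurableSet[H] s) (hu : MeasurableSet u) :
    ∫ ω in s, (P⟦u | H⟧) ω ∂P = P.real (s ∩ u) := by
  rw [setIntegral_condExp hH ((integrable_const (1 : ℝ)).indicator hu) hs, setIntegral_indicator hu]
  simp

/-- Conditional independence transfers a conditional probability to the larger σ-field. -/
theorem CondIndepSigma.hasCondProb {F F' G mΩ : MeasurableSpace Ω} {P : Measure Ω}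
    [IsFiniteMeasure P] (hF : F ≤ mΩ) (hF' : F' ≤ mΩ) (hG : G ≤ mΩ)
    (hci : CondIndepSigma P F F' G) {s u : Set Ω} {p : ℝ≥0} (hs : MeasurableSet[F] s)
    (hu : MeasurableSet[F'] u) (h : HasCondProb P F s u p) : HasCondProb P G s u p := by
  intro t ht
  have e := h.condExp_eq hF hs (hF' u hu)
  -- Integrate the conditional factorisation of `u ∩ t` over `s`, where the conditional probability
  -- of `u` given `F` is the constant `p`.
  have h1 : P.real (s ∩ (u ∩ t)) = p * P.real (s ∩ t) := by
    have hu' := hF' u hu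
    rw [← setIntegral_condProb hF hs (hu'.inter (hG t ht)),
      ← setIntegral_condProb hF hs (hG t ht), ← integral_const_mul]
    refine setIntegral_congr_ae (hF s hs) ?_
    filter_upwards [hci u t hu ht, e] with ω h1 h2 hω
    rw [h1, Pi.mul_apply]
    rw [Set.indicator_of_mem hω, Set.indicator_of_mem hω] at h2
    rw [h2]
  have e1 : t ∩ s ∩ u = s ∩ (u ∩ t) := by ext; simp; tauto
  rw [e1, Set.inter_comm t s, ← ENNReal.toReal_eq_toReal_iff' (by finiteness) (by finiteness),
    ENNReal.toReal_mul]
  exact h1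

theorem HasCondProb.prod_fst {Ω' : Type*} {H mΩ : MeasurableSpace Ω} {H' mΩ' : MeasurableSpace Ω'}
    {P : Measure Ω} {P' : Measure Ω'} [IsProbabilityMeasure P] [IsProbabilityMeasure P']
    (hH : H ≤ mΩ) (hH' : H' ≤ mΩ')
    {s u : Set Ω} {p : ℝ≥0} (h : HasCondProb P H s u p) :
    HasCondProb (P.prod P') (@Prod.instMeasurableSpace Ω Ω' H H')
      (Prod.fst ⁻¹' s) (Prod.fst ⁻¹' u) p := by
  have hprod : ∀ (a : Set Ω) (b : Set Ω'), (P.prod P') (a ×ˢ b) = P a * P' b :=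
    fun a b => Measure.prod_prod a b
  refine HasCondProb.of_isPiSystem (sup_le_sup (MeasurableSpace.comap_mono hH)
    (MeasurableSpace.comap_mono hH')) (@isPiSystem_prod Ω Ω' H H') (@generateFrom_prod Ω Ω' H H').symm ?_ ?_
  · have := h Set.univ MeasurableSet.univ
    simp only [Set.univ_inter] at this
    rw [← Set.preimage_inter, ← Set.prod_univ, ← Set.prod_univ, hprod, hprod, this, mul_assoc]
  · rintro _ ⟨a, ha, b, hb, rfl⟩
    have e1 : a ×ˢ b ∩ Prod.fst ⁻¹' s = (a ∩ s) ×ˢ b := by ext; simp; tauto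
    have e2 : a ×ˢ b ∩ Prod.fst ⁻¹' s ∩ Prod.fst ⁻¹' u = (a ∩ s ∩ u) ×ˢ b := by
      ext; simp; tauto
    rw [e2, e1, hprod, hprod, h a ha, mul_assoc]

theorem HasCondProb.prod_snd {Ω' : Type*} {H mΩ : MeasurableSpace Ω} {H' mΩ' : MeasurableSpace Ω'}
    {P : Measure Ω} {P' : Measure Ω'} [IsProbabilityMeasure P] [IsProbabilityMeasure P']
    (hH : H ≤ mΩ) (hH' : H' ≤ mΩ')
    {s u : Set Ω'} {p : ℝ≥0} (h : HasCondProb P' H' s u p) (hs : MeasurableSet s)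
    (hu : MeasurableSet u) :
    HasCondProb (P.prod P') (@Prod.instMeasurableSpace Ω Ω' H H')
      (Prod.snd ⁻¹' s) (Prod.snd ⁻¹' u) p := by
  rw [← Measure.prod_swap (μ := P') (ν := P)]
  refine HasCondProb.map measurable_swap (h.prod_fst (P' := P) hH' hH)
    (sup_le_sup (MeasurableSpace.comap_mono hH) (MeasurableSpace.comap_mono hH'))
    (measurable_snd hs) (measurable_snd hu) ?_
  intro t ht
  exact @measurable_swap Ω' Ω H' H t ht

end CondProb

/-! ### From transition probabilities to conditional independence -/

section Immersion

variable {Ω : Type*}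

/-- Events that can be sliced along the values of `V` form a σ-field containing `F` and σ(`V`). The
slices let `condProb_eq_of_le` work one value of `V` at a time. -/
theorem exists_of_measurableSet_sup_comap {F : MeasurableSpace Ω} {B : Type*}
    [MeasurableSpace B] {V : Ω → B} {s : Set Ω}
    (hs : MeasurableSet[F ⊔ MeasurableSpace.comap V inferInstance] s) :
    ∃ S : B → Set Ω, (∀ b, MeasurableSet[F] (S b)) ∧ s = {ω | ω ∈ S (V ω)} := by
  classical
  rw [MeasurableSpace.measurableSet_sup] at hs
  induction hs with
  | basic t ht =>
    rcases ht with ht | ⟨T, -, rfl⟩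
    · exact ⟨fun _ => t, fun _ => ht, rfl⟩
    · refine ⟨fun b => {_ω | b ∈ T}, fun b => MeasurableSet.const _, rfl⟩
  | empty => exact ⟨fun _ => ∅, fun _ => MeasurableSet.empty, by simp⟩
  | compl t _ ih =>
    obtain ⟨S, hS, rfl⟩ := ih
    exact ⟨fun b => (S b)ᶜ, fun b => (hS b).compl, rfl⟩
  | iUnion f _ ih =>
    choose S hS hf using ih
    refine ⟨fun b => ⋃ n, S n b, fun b => MeasurableSet.iUnion fun n => hS n b, ?_⟩
    ext ω
    simp only [Set.mem_iUnion, Set.mem_ofPred_eq]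
    exact exists_congr fun n => by rw [hf n]; rfl

theorem condProb_preimage_eq {H mΩ : MeasurableSpace Ω} {P : Measure Ω} [IsFiniteMeasure P]
    (hH : H ≤ mΩ) {A B : Type*} [Countable A] [MeasurableSpace A] [MeasurableSingletonClass A]
    [MeasurableSpace B] [MeasurableSingletonClass B] {U : Ω → A} {V : Ω → B}
    (hU : Measurable[H] U) (hV : Measurable V) {p : A → B → ℝ≥0}
    (h : ∀ a b, HasCondProb P H (U ⁻¹' {a}) (V ⁻¹' {b}) (p a b)) (b : B) :
    P⟦V ⁻¹' {b} | H⟧ =ᵐ[P] fun ω => (p (U ω) b : ℝ) := by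
  have h1 : ∀ᵐ ω ∂P, ∀ a, (U ⁻¹' {a}).indicator (P⟦V ⁻¹' {b} | H⟧) ω
      = (U ⁻¹' {a}).indicator (fun _ => (p a b : ℝ)) ω := by
    rw [ae_all_iff]
    exact fun a => (h a b).condExp_eq hH (hU (measurableSet_singleton a))
      (hV (measurableSet_singleton b))
  filter_upwards [h1] with ω hω
  have := hω (U ω)
  have hmem : ω ∈ U ⁻¹' {U ω} := rfl
  rwa [Set.indicator_of_mem hmem, Set.indicator_of_mem hmem] at this

/-- Slice `s` along the finitely many values of `V`: each slice is in `F` and comes out of the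
conditional expectation. What remains is the conditional law of `V`, a function of the
`F`-measurable `U`, hence the same for `F` and `G`. -/
theorem condProb_eq_of_le {F G mΩ : MeasurableSpace Ω} {P : Measure Ω} [IsFiniteMeasure P]
    (hFG : F ≤ G) (hG : G ≤ mΩ) {A B : Type*} [Countable A] [MeasurableSpace A]
    [MeasurableSingletonClass A] [Finite B] [MeasurableSpace B] [MeasurableSingletonClass B]
    {U : Ω → A} {V : Ω → B} (hU : Measurable[F] U) (hV : Measurable V) {p : A → B → ℝ≥0}
    (h : ∀ a b, HasCondProb P G (U ⁻¹' {a}) (V ⁻¹' {b}) (p a b)) {s : Set Ω}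
    (hs : MeasurableSet[F ⊔ MeasurableSpace.comap V inferInstance] s) :
    P⟦s | G⟧ =ᵐ[P] P⟦s | F⟧ := by
  classical
  cases nonempty_fintype B
  obtain ⟨S, hS, rfl⟩ := exists_of_measurableSet_sup_comap hs
  have hVb : ∀ b, MeasurableSet (V ⁻¹' {b}) := fun b => hV (measurableSet_singleton b)
  have hint : ∀ b, Integrable ((V ⁻¹' {b}).indicator fun _ => (1 : ℝ)) P :=
    fun b => (integrable_const 1).indicator (hVb b)
  have e : ({ω | ω ∈ S (V ω)} : Set Ω).indicator (fun _ => (1 : ℝ))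
      = ∑ b, (S b).indicator ((V ⁻¹' {b}).indicator fun _ => (1 : ℝ)) := by
    funext ω
    rw [Finset.sum_apply, Finset.sum_eq_single (V ω)]
    · simp [Set.indicator_apply]
    · intro b _ hb
      simp [Set.indicator_apply, hb.symm]
    · simp
  have key : ∀ H : MeasurableSpace Ω, F ≤ H → H ≤ G →
      P⟦{ω | ω ∈ S (V ω)} | H⟧ =ᵐ[P] ∑ b, (S b).indicator fun ω => (p (U ω) b : ℝ) := by
    intro H hFH hHG
    have hH := hHG.trans hG
    rw [e]
    refine (condExp_finsetSum (fun b _ => (hint b).indicator (hH _ (hFH _ (hS b)))) H).trans ?_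
    have h2 : ∀ᵐ ω ∂P, ∀ b, (P[(S b).indicator ((V ⁻¹' {b}).indicator fun _ => (1 : ℝ)) | H]) ω
        = (S b).indicator (fun ω => (p (U ω) b : ℝ)) ω := by
      rw [ae_all_iff]
      intro b
      refine (condExp_indicator (hint b) (hFH _ (hS b))).trans ?_
      filter_upwards [condProb_preimage_eq hH (hU.mono hFH le_rfl) hV
        (fun a b => (h a b).mono hHG) b] with ω hω
      simp only [Set.indicator_apply, hω]
    filter_upwards [h2] with ω hω
    rw [Finset.sum_apply, Finset.sum_apply]
    exact Finset.sum_congr rfl fun b _ => hω b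
  exact (key G hFG le_rfl).trans (key F le_rfl hFG).symm

/-- Tower property: condition on `G` to replace the indicator of `s` by its conditional probability
given `F`, then condition on `F` and pull that factor out. -/
theorem condIndepSigma_of_condProb_eq {F F' G mΩ : MeasurableSpace Ω} {P : Measure Ω}
    [IsFiniteMeasure P] (hFG : F ≤ G) (hG : G ≤ mΩ) (hF' : F' ≤ mΩ)
    (h : ∀ s, MeasurableSet[F'] s → P⟦s | G⟧ =ᵐ[P] P⟦s | F⟧) : CondIndepSigma P F F' G := by
  intro s t hs ht
  have hs' := hF' s hs
  have ht' := hG t ht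
  have hints : Integrable (s.indicator fun _ => (1 : ℝ)) P := (integrable_const 1).indicator hs'
  have hintt : Integrable (t.indicator fun _ => (1 : ℝ)) P := (integrable_const 1).indicator ht'
  have e1 : (s ∩ t).indicator (fun _ => (1 : ℝ)) = t.indicator (s.indicator fun _ => (1 : ℝ)) := by
    rw [Set.indicator_indicator, Set.inter_comm]
  have e2 : P⟦s | F⟧ * t.indicator (fun _ => (1 : ℝ)) = t.indicator (P⟦s | F⟧) := by
    funext ω
    by_cases hω : ω ∈ t <;> simp [hω]
  rw [e1]
  refine (condExp_condExp_of_le hFG hG).symm.trans ?_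
  refine (condExp_congr_ae (g := P⟦s | F⟧ * t.indicator (fun _ => (1 : ℝ))) ?_).trans ?_
  · refine (condExp_indicator hints ht).trans ?_
    rw [e2]
    filter_upwards [h s hs] with ω hω
    classical
    rw [Set.indicator_apply, Set.indicator_apply, hω]
  · refine condExp_mul_of_stronglyMeasurable_left stronglyMeasurable_condExp ?_ hintt
    rw [e2]
    exact integrable_condExp.indicator ht'

end Immersion

/-! ### Markov processes and immersion of natural filtrations -/

section Processes

variable {Ω ι : Type*}

theorem le_completion {m mΩ : MeasurableSpace Ω} (hm : m ≤ mΩ) (μ : Measure Ω) :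
    m ≤ completion μ m :=
  le_inf (fun s hs => ⟨s, hs, ae_eq_refl s⟩) hm

theorem iSup_comap_le {mΩ : MeasurableSpace Ω} [Preorder ι] {E : ι → Type*}
    [∀ i, MeasurableSpace (E i)] {X : (i : ι) → Ω → E i} (hX : ∀ i, Measurable (X i)) (i : ι) :
    (⨆ j ≤ i, MeasurableSpace.comap (X j) inferInstance) ≤ mΩ :=
  iSup₂_le fun j _ => (hX j).comap_le

theorem comap_le_naturalFiltration {mΩ : MeasurableSpace Ω} [Preorder ι] {E : ι → Type*}
    [∀ i, MeasurableSpace (E i)] {X : (i : ι) → Ω → E i} (hX : ∀ i, Measurable (X i))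
    (μ : Measure Ω) {i j : ι} (hij : j ≤ i) :
    MeasurableSpace.comap (X j) inferInstance ≤ naturalFiltration μ X i :=
  (le_iSup₂_of_le j hij le_rfl).trans (le_completion (iSup_comap_le hX i) μ)

theorem IsMarkov.exists_hasCondProb {mΩ : MeasurableSpace Ω} [Preorder ι] {E : ι → Type*}
    [∀ i, MeasurableSpace (E i)] [∀ i, MeasurableSingletonClass (E i)]
    {X : (i : ι) → Ω → E i} (hX : ∀ i, Measurable (X i)) {μ : Measure Ω} [IsFiniteMeasure μ]
    (h : IsMarkov μ X) {i j : ι} (hij : i ⋖ j) :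
    ∃ p : E i → E j → ℝ≥0, ∀ a b,
      HasCondProb μ (naturalFiltration μ X i) (X i ⁻¹' {a}) (X j ⁻¹' {b}) (p a b) := by
  suffices H : ∀ a b, ∃ p : ℝ≥0,
      HasCondProb μ (naturalFiltration μ X i) (X i ⁻¹' {a}) (X j ⁻¹' {b}) p by
    choose p hp using H
    exact ⟨p, hp⟩
  intro a b
  have hle : naturalFiltration μ X i ≤ mΩ := (naturalFiltration μ X).le i
  obtain ⟨g, -, hg⟩ : ∃ g : E i → ℝ, Measurable g ∧
      μ⟦X j ⁻¹' {b} | MeasurableSpace.comap (X i) inferInstance⟧ = g ∘ X i :=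
    (stronglyMeasurable_condExp.measurable).exists_eq_measurable_comp
  have hae := h i j hij {b} (measurableSet_singleton b)
  have hb : MeasurableSet (X j ⁻¹' {b}) := hX j (measurableSet_singleton b)
  have ha : MeasurableSet[naturalFiltration μ X i] (X i ⁻¹' {a}) :=
    comap_le_naturalFiltration hX μ le_rfl _ ⟨{a}, measurableSet_singleton a, rfl⟩
  have key : ∀ t, MeasurableSet[naturalFiltration μ X i] t →
      μ.real (t ∩ X i ⁻¹' {a} ∩ X j ⁻¹' {b}) = g a * μ.real (t ∩ X i ⁻¹' {a}) := by
    intro t ht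
    rw [← setIntegral_condProb hle (ht.inter ha) hb, mul_comm, ← smul_eq_mul,
      ← setIntegral_const]
    refine setIntegral_congr_ae (hle _ (ht.inter ha)) ?_
    filter_upwards [hae] with ω hω hω'
    rw [hω, hg, Function.comp_apply, show X i ω = a from hω'.2]
  refine ⟨(g a).toNNReal, fun t ht => ?_⟩
  rw [← ENNReal.toReal_eq_toReal_iff' (by finiteness) (by finiteness), ENNReal.toReal_mul]
  refine (key t ht).trans ?_
  rcases le_or_gt 0 (g a) with hga | hga
  · rw [ENNReal.coe_toReal, Real.coe_toNNReal _ hga]; rfl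
  -- The factor `g` is arbitrary off the essential range of `X i`. A negative value `g a` forces the
  -- event to be null, so truncating it at `0` is harmless.
  · have h0 : μ.real (t ∩ X i ⁻¹' {a}) = 0 := by
      have h1 : 0 ≤ g a * μ.real (t ∩ X i ⁻¹' {a}) := key t ht ▸ measureReal_nonneg
      have h2 : 0 ≤ μ.real (t ∩ X i ⁻¹' {a}) := measureReal_nonneg
      nlinarith
    rw [h0, mul_zero]
    exact (mul_eq_zero_of_right _ h0).symm

/-- When `i` immediately precedes `j` in a linear order, the natural σ-field at `j` is, up to null
sets, the one at `i` enriched by `X j`. Immersion then only concerns the conditional law of `X j`.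
-/
theorem immersed_naturalFiltration {mΩ : MeasurableSpace Ω} [LinearOrder ι] {E : ι → Type*}
    [∀ i, Finite (E i)] [∀ i, MeasurableSpace (E i)] [∀ i, MeasurableSingletonClass (E i)]
    {X : (i : ι) → Ω → E i} (hX : ∀ i, Measurable (X i)) {P : Measure Ω} [IsFiniteMeasure P]
    {G : Filtration ι mΩ} (hG : ∀ i, naturalFiltration P X i ≤ G i)
    {p : (i j : ι) → E i → E j → ℝ≥0}
    (h : ∀ i j, i ⋖ j → ∀ a b, HasCondProb P (G i) (X i ⁻¹' {a}) (X j ⁻¹' {b}) (p i j a b)) :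
    Immersed P (naturalFiltration P X) G := by
  refine ⟨hG, fun i j hij => ?_⟩
  refine condIndepSigma_of_condProb_eq (hG i) (G.le i) ((naturalFiltration P X).le j) ?_
  intro s hs
  obtain ⟨⟨t, ht, hst⟩, -⟩ := measurableSet_completion_iff.1 hs
  have e : s.indicator (fun _ => (1 : ℝ)) =ᵐ[P] t.indicator fun _ => (1 : ℝ) :=
    indicator_ae_eq_of_ae_eq_set hst
  refine (condExp_congr_ae e).trans (EventuallyEq.trans ?_ (condExp_congr_ae e).symm)
  refine condProb_eq_of_le (hG i) (G.le i) (U := X i) (V := X j) ?_ (hX j) (h i j hij) ?_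
  · exact measurable_iff_comap_le.2 (comap_le_naturalFiltration hX P le_rfl)
  · refine (iSup₂_le fun k hk => ?_ : (⨆ k ≤ j, MeasurableSpace.comap (X k) inferInstance) ≤ _) t ht
    rcases hk.lt_or_eq with hk | rfl
    · exact (comap_le_naturalFiltration hX P (hij.le_of_lt hk)).trans le_sup_left
    · exact le_sup_right

end Processes

/-! ### The brick inequality for two copies in a common filtration -/

section Bricks

/-- Two copies of a triple with the same transition probabilities with respect to a common
filtration satisfy the inequality of Tsirelson bricks, on every event that forces the initial
values to be different. -/
theorem IsTsirelsonBrick.le_measureReal_inter {Ω : Type*} {mΩ : MeasurableSpace Ω}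
    {μ : Measure Ω} {E : Fin 3 → Type*} [∀ k, Fintype (E k)] [∀ k, MeasurableSpace (E k)]
    [∀ k, MeasurableSingletonClass (E k)] {α : ℝ} {Z : (k : Fin 3) → Ω → E k}
    (hZ : IsTsirelsonBrick μ α Z) {Ω' : Type} {mΩ' : MeasurableSpace Ω'} {P : Measure Ω'}
    [IsProbabilityMeasure P] {G : Fin 3 → MeasurableSpace Ω'} (hmono : Monotone G)
    (hG : ∀ k, G k ≤ mΩ') {Z' Z'' : (k : Fin 3) → Ω' → E k}
    (hZ' : ∀ k, Measurable[G k] (Z' k)) (hZ'' : ∀ k, Measurable[G k] (Z'' k))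
    (law' : P.map (fun ω k => Z' k ω) = μ.map fun ω k => Z k ω)
    (law'' : P.map (fun ω k => Z'' k ω) = μ.map fun ω k => Z k ω)
    {p : (i j : Fin 3) → E i → E j → ℝ≥0}
    (h' : ∀ i j, i ⋖ j → ∀ a b, HasCondProb P (G i) (Z' i ⁻¹' {a}) (Z' j ⁻¹' {b}) (p i j a b))
    (h'' : ∀ i j, i ⋖ j → ∀ a b,
      HasCondProb P (G i) (Z'' i ⁻¹' {a}) (Z'' j ⁻¹' {b}) (p i j a b))
    {D : Set (E 0 × E 0)} (hD : ∀ x ∈ D, x.1 ≠ x.2) :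
    (1 - α) * P.real {ω | (Z' 0 ω, Z'' 0 ω) ∈ D} ≤
      P.real ({ω | (Z' 0 ω, Z'' 0 ω) ∈ D} ∩ {ω | Z' 2 ω ≠ Z'' 2 ω}) := by
  have mZ' : ∀ k, Measurable (Z' k) := fun k => (hZ' k).mono (hG k) le_rfl
  have mZ'' : ∀ k, Measurable (Z'' k) := fun k => (hZ'' k).mono (hG k) le_rfl
  have mZZ : ∀ k, Measurable fun ω => (Z' k ω, Z'' k ω) := fun k => (mZ' k).prodMk (mZ'' k)
  have hle : ∀ i, (⨆ j ≤ i, MeasurableSpace.comap (fun ω => (Z' j ω, Z'' j ω)) inferInstance)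
      ≤ G i := fun i => iSup₂_le fun j hj =>
    (measurable_iff_comap_le.1 ((hZ' j).prodMk (hZ'' j))).trans (hmono hj)
  have nat_le : ∀ (Y : (k : Fin 3) → Ω' → E k),
      (∀ k, MeasurableSpace.comap (Y k) inferInstance ≤
        MeasurableSpace.comap (fun ω => (Z' k ω, Z'' k ω)) inferInstance) → ∀ i,
      naturalFiltration P Y i ≤ naturalFiltration P (fun k ω => (Z' k ω, Z'' k ω)) i :=
    fun Y hY i => completion_mono P (iSup₂_mono fun j _ => hY j)
  have c1 : ∀ k, MeasurableSpace.comap (Z' k) inferInstance ≤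
        MeasurableSpace.comap (fun ω => (Z' k ω, Z'' k ω)) inferInstance := by
    intro k
    rw [← measurable_iff_comap_le]
    exact measurable_fst.comp (comap_measurable fun ω => (Z' k ω, Z'' k ω))
  have c2 : ∀ k, MeasurableSpace.comap (Z'' k) inferInstance ≤
        MeasurableSpace.comap (fun ω => (Z' k ω, Z'' k ω)) inferInstance := by
    intro k
    rw [← measurable_iff_comap_le]
    exact measurable_snd.comp (comap_measurable fun ω => (Z' k ω, Z'' k ω))
  -- The natural filtration of the pair lies between those of the two copies and (up to completion)
  -- `G`. Transition probabilities valid for `G` therefore restrict to it and give both immersions.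
  have hcoup : IsNonAnticipativeCoupling μ Z P Z' Z'' :=
    { measurable_left := mZ'
      measurable_right := mZ''
      law_left := law'
      law_right := law''
      immersed_left := immersed_naturalFiltration mZ' (nat_le Z' c1)
        fun i j hij a b => ((h' i j hij a b).mono (hle i)).completion
      immersed_right := immersed_naturalFiltration mZ'' (nat_le Z'' c2)
        fun i j hij a b => ((h'' i j hij a b).mono (hle i)).completion }
  have hbr := hZ.coupling Ω' mΩ' P inferInstance Z' Z'' hcoup
  have hDm : MeasurableSet[MeasurableSpace.comap (fun ω => (Z' 0 ω, Z'' 0 ω)) inferInstance]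
      {ω | (Z' 0 ω, Z'' 0 ω) ∈ D} := ⟨D, D.toFinite.measurableSet, rfl⟩
  have hne : MeasurableSet {ω | Z' 2 ω ≠ Z'' 2 ω} :=
    mZZ 2 ({x : E 2 × E 2 | x.1 ≠ x.2}.toFinite.measurableSet)
  rw [← setIntegral_condProb (mZZ 0).comap_le hDm hne, mul_comm, ← smul_eq_mul,
    ← setIntegral_const]
  refine setIntegral_mono_ae_restrict (integrable_const _).integrableOn
    integrable_condExp.integrableOn ?_
  refine (ae_restrict_iff' ((mZZ 0).comap_le _ hDm)).2 ?_
  filter_upwards [hbr] with ω hω hωD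
  exact hω (hD _ hωD)

theorem IsUniformRV.measureReal_preimage_singleton {Ω : Type*} {mΩ : MeasurableSpace Ω}
    {μ : Measure Ω} {E : Type*} [Fintype E] [MeasurableSpace E] [MeasurableSingletonClass E]
    {X : Ω → E} (hX : IsUniformRV μ X) (a : E) :
    μ.real (X ⁻¹' {a}) = (Fintype.card E : ℝ)⁻¹ := by
  rw [← map_measureReal_apply hX.1 (measurableSet_singleton a), hX.2, Measure.real,
    uniformOn_univ]
  simp

theorem Pi.map_eq_of_forall_singleton {Ω Ω' ι : Type*} [Finite ι] {mΩ : MeasurableSpace Ω}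
    {mΩ' : MeasurableSpace Ω'} {μ : Measure Ω} {μ' : Measure Ω'} {E : ι → Type*}
    [∀ k, Finite (E k)] [∀ k, MeasurableSpace (E k)] [∀ k, MeasurableSingletonClass (E k)]
    {X : (k : ι) → Ω → E k} {X' : (k : ι) → Ω' → E k} (hX : ∀ k, Measurable (X k))
    (hX' : ∀ k, Measurable (X' k))
    (h : ∀ a : (k : ι) → E k, μ (⋂ k, X k ⁻¹' {a k}) = μ' (⋂ k, X' k ⁻¹' {a k})) :
    μ.map (fun ω k => X k ω) = μ'.map fun ω k => X' k ω := by
  refine Measure.ext_of_singleton fun a => ?_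
  rw [Measure.map_apply (measurable_pi_lambda _ hX) (measurableSet_singleton a),
    Measure.map_apply (measurable_pi_lambda _ hX') (measurableSet_singleton a)]
  convert h a using 2 <;>
  · ext ω
    simp [funext_iff]

end Bricks

/-! ### Lower bound on the size of a brick's final state space -/

section BrickSize

theorem IsMarkov.exists_transition {Ω ι : Type*} {mΩ : MeasurableSpace Ω} [Preorder ι]
    {E : ι → Type*} [∀ i, MeasurableSpace (E i)] [∀ i, MeasurableSingletonClass (E i)]
    {X : (i : ι) → Ω → E i} (hX : ∀ i, Measurable (X i)) {μ : Measure Ω} [IsFiniteMeasure μ]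
    (h : IsMarkov μ X) :
    ∃ p : (i j : ι) → E i → E j → ℝ≥0, ∀ i j, i ⋖ j → ∀ a b,
      HasCondProb μ (naturalFiltration μ X i) (X i ⁻¹' {a}) (X j ⁻¹' {b}) (p i j a b) := by
  have H : ∀ i j, ∃ p : E i → E j → ℝ≥0, i ⋖ j → ∀ a b,
      HasCondProb μ (naturalFiltration μ X i) (X i ⁻¹' {a}) (X j ⁻¹' {b}) (p a b) := by
    intro i j
    by_cases hij : i ⋖ j
    · obtain ⟨p, hp⟩ := h.exists_hasCondProb hX hij
      exact ⟨p, fun _ => hp⟩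
    · exact ⟨fun _ _ => 0, fun h => absurd h hij⟩
  choose p hp using H
  exact ⟨p, hp⟩

theorem measurable_iSup_comap {Ω ι : Type*} [Preorder ι] {E : ι → Type*}
    [∀ i, MeasurableSpace (E i)] (Y : (i : ι) → Ω → E i) {i j : ι} (hij : j ≤ i) :
    Measurable[⨆ j ≤ i, MeasurableSpace.comap (Y j) inferInstance] (Y j) :=
  measurable_iff_comap_le.2
    (le_iSup₂_of_le (f := fun j (_ : j ≤ i) => MeasurableSpace.comap (Y j) inferInstance)
      j hij le_rfl)

theorem measurable_to_iSup_comap {Ω Ω' ι : Type*} {m : MeasurableSpace Ω} [Preorder ι]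
    {E : ι → Type*} [∀ i, MeasurableSpace (E i)] (Y : (i : ι) → Ω' → E i) {φ : Ω → Ω'} {i : ι}
    (h : ∀ j ≤ i, Measurable (Y j ∘ φ)) :
    @Measurable _ _ m (⨆ j ≤ i, MeasurableSpace.comap (Y j) inferInstance) φ := by
  rw [measurable_iff_comap_le, MeasurableSpace.comap_iSup]
  simp only [MeasurableSpace.comap_iSup, MeasurableSpace.comap_comp]
  exact iSup₂_le fun j hj => measurable_iff_comap_le.1 (h j hj)

/-- The state space of the last variable of a Tsirelson `α`-brick has at least `1 / α` elements,
unless the initial variable is constant. -/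
theorem IsTsirelsonBrick.inv_card_le {Ω : Type*} {mΩ : MeasurableSpace Ω} {μ : Measure Ω}
    [IsProbabilityMeasure μ] {E : Fin 3 → Type*} [∀ k, Fintype (E k)]
    [∀ k, MeasurableSpace (E k)] [∀ k, MeasurableSingletonClass (E k)] {α : ℝ}
    {Z : (k : Fin 3) → Ω → E k} (hZ : IsTsirelsonBrick μ α Z) (hE : 1 < Fintype.card (E 0)) :
    (Fintype.card (E 2) : ℝ)⁻¹ ≤ α := by
  classical
  have mZ : ∀ k, Measurable (Z k) := fun k => (hZ.uniform k).1
  obtain ⟨p, hp⟩ := hZ.markov.exists_transition mZ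
  -- The brick inequality speaks of spaces in `Type` only, so the law of the triple is carried to a
  -- product of `Fin` types.
  let e := fun k => Fintype.equivFin (E k)
  let enc : Ω → (k : Fin 3) → Fin (Fintype.card (E k)) := fun ω k => e k (Z k ω)
  have menc : Measurable enc :=
    measurable_pi_lambda _ fun k => (measurable_of_finite (e k)).comp (mZ k)
  let P₀ := μ.map enc
  have : IsProbabilityMeasure P₀ := Measure.isProbabilityMeasure_map menc.aemeasurable
  let z : (k : Fin 3) → ((k : Fin 3) → Fin (Fintype.card (E k))) → E k :=
    fun k x => (e k).symm (x k)
  have zenc : ∀ k, z k ∘ enc = Z k := fun k => by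
    funext ω; exact (e k).symm_apply_apply _
  have mz : ∀ k, Measurable (z k) := fun k => measurable_of_finite _
  let H : Fin 3 → MeasurableSpace ((k : Fin 3) → Fin (Fintype.card (E k))) :=
    fun i => ⨆ j ≤ i, MeasurableSpace.comap (z j) inferInstance
  have hHmono : Monotone H := fun i j hij => biSup_mono fun _ h => h.trans hij
  have hH : ∀ i, H i ≤ MeasurableSpace.pi := fun i => iSup_comap_le mz i
  have mzH : ∀ k, Measurable[H k] (z k) := fun k => measurable_iSup_comap z le_rfl
  have hz : ∀ i j, i ⋖ j → ∀ a b,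
      HasCondProb P₀ (H i) (z i ⁻¹' {a}) (z j ⁻¹' {b}) (p i j a b) := by
    intro i j hij a b
    refine HasCondProb.map menc (H := naturalFiltration μ Z i) ?_ (hH i)
      (mz i (measurableSet_singleton a)) (mz j (measurableSet_singleton b)) ?_
    · rw [← Set.preimage_comp, ← Set.preimage_comp, zenc, zenc]
      exact hp i j hij a b
    · intro t ht
      refine measurable_to_iSup_comap z (fun j hj => ?_) ht
      rw [zenc]
      exact measurable_iff_comap_le.2 (comap_le_naturalFiltration mZ μ hj)
  have hlaw : ∀ Y : (k : Fin 3) → _ → E k,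
      (∃ f : _ → _, MeasurePreserving f (P₀.prod P₀) P₀ ∧ ∀ k, Y k = z k ∘ f) →
      (P₀.prod P₀).map (fun ω k => Y k ω) = μ.map fun ω k => Z k ω := by
    rintro Y ⟨f, hf, hY⟩
    have h1 : (fun ω k => Y k ω) = (fun x k => z k x) ∘ f := by
      funext ω k; rw [hY]; rfl
    have h2 : (fun ω k => Z k ω) = (fun x k => z k x) ∘ enc := by
      funext ω k; rw [← zenc]; rfl
    rw [h1, h2, ← Measure.map_map (measurable_pi_lambda _ mz) hf.measurable, hf.map_eq,
      ← Measure.map_map (measurable_pi_lambda _ mz) menc]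
  have hcard : ∀ k c, P₀.real (z k ⁻¹' {c}) = (Fintype.card (E k) : ℝ)⁻¹ := by
    intro k c
    rw [map_measureReal_apply menc (mz k (measurableSet_singleton c)), ← Set.preimage_comp, zenc]
    exact (hZ.uniform k).measureReal_preimage_singleton c
  have hcard2 : ∀ a c, P₀.real (z 0 ⁻¹' {a} ∩ z 2 ⁻¹' {c}) =
      (Fintype.card (E 0) : ℝ)⁻¹ * (Fintype.card (E 2) : ℝ)⁻¹ := by
    intro a c
    rw [← hcard 0 a, ← hcard 2 c, map_measureReal_apply menc
      ((mz 0 (measurableSet_singleton a)).inter (mz 2 (measurableSet_singleton c))),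
      map_measureReal_apply menc (mz 0 (measurableSet_singleton a)),
      map_measureReal_apply menc (mz 2 (measurableSet_singleton c)),
      Set.preimage_inter, ← Set.preimage_comp, ← Set.preimage_comp, zenc, zenc, Measure.real,
      hZ.indep.measure_inter_preimage_eq_mul _ _ (measurableSet_singleton a)
        (measurableSet_singleton c), ENNReal.toReal_mul]
    rfl
  obtain ⟨a, a', haa'⟩ := Fintype.exists_pair_of_one_lt_card hE
  -- Two independent copies of the triple, on the event that they start from the distinct values `a`
  -- and `a'`.
  have key := hZ.le_measureReal_inter (P := P₀.prod P₀)
    (G := fun i => @Prod.instMeasurableSpace _ _ (H i) (H i))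
    (fun i j hij => sup_le_sup (MeasurableSpace.comap_mono (hHmono hij))
      (MeasurableSpace.comap_mono (hHmono hij)))
    (fun i => sup_le_sup (MeasurableSpace.comap_mono (hH i))
      (MeasurableSpace.comap_mono (hH i)))
    (Z' := fun k => z k ∘ Prod.fst) (Z'' := fun k => z k ∘ Prod.snd)
    (fun k => (mzH k).comp (@measurable_fst _ _ (H k) (H k)))
    (fun k => (mzH k).comp (@measurable_snd _ _ (H k) (H k)))
    (hlaw _ ⟨Prod.fst, measurePreserving_fst, fun _ => rfl⟩)
    (hlaw _ ⟨Prod.snd, measurePreserving_snd, fun _ => rfl⟩)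
    (fun i j hij a b => (hz i j hij a b).prod_fst (hH i) (hH i))
    (fun i j hij a b => (hz i j hij a b).prod_snd (hH i) (hH i)
      (mz i (measurableSet_singleton a)) (mz j (measurableSet_singleton b)))
    (D := {(a, a')}) (by rintro x rfl; exact haa')
  have e1 : {ω : _ × _ | ((z 0 ∘ Prod.fst) ω, (z 0 ∘ Prod.snd) ω) ∈ ({(a, a')} : Set (E 0 × E 0))}
      = (z 0 ⁻¹' {a}) ×ˢ (z 0 ⁻¹' {a'}) := by
    ext ω; simp
  -- Agreement at the final time is a disjoint union of rectangles over the common value `c`. Their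
  -- masses are explicit because initial and final values are independent.
  have e2 : (z 0 ⁻¹' {a}) ×ˢ (z 0 ⁻¹' {a'}) ∩ {ω | (z 2 ∘ Prod.fst) ω ≠ (z 2 ∘ Prod.snd) ω}
      = (z 0 ⁻¹' {a}) ×ˢ (z 0 ⁻¹' {a'}) \
        ⋃ c ∈ (Finset.univ : Finset (E 2)), (z 0 ⁻¹' {a} ∩ z 2 ⁻¹' {c}) ×ˢ
          (z 0 ⁻¹' {a'} ∩ z 2 ⁻¹' {c}) := by
    ext ω
    simp
    grind
  rw [e1, e2, measureReal_sdiff, measureReal_biUnion_finset] at key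
  · simp only [measureReal_prod_prod, hcard, hcard2] at key
    have h0 : (0 : ℝ) < Fintype.card (E 0) := by exact_mod_cast (zero_lt_one.trans hE)
    have h2 : (0 : ℝ) < Fintype.card (E 2) := by
      have : Nonempty (E 2) := (μ.nonempty_of_neZero).map (Z 2)
      exact_mod_cast Fintype.card_pos
    rw [Finset.sum_const, Finset.card_univ, nsmul_eq_mul] at key
    have h3 : (0 : ℝ) < (Fintype.card (E 0) : ℝ)⁻¹ * (Fintype.card (E 0) : ℝ)⁻¹ := by positivity
    have h4 : (Fintype.card (E 2) : ℝ) * ((Fintype.card (E 0) : ℝ)⁻¹ * (Fintype.card (E 2) : ℝ)⁻¹ *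
        ((Fintype.card (E 0) : ℝ)⁻¹ * (Fintype.card (E 2) : ℝ)⁻¹)) =
        (Fintype.card (E 0) : ℝ)⁻¹ * (Fintype.card (E 0) : ℝ)⁻¹ * (Fintype.card (E 2) : ℝ)⁻¹ := by
      field_simp
    rw [h4] at key
    nlinarith
  · intro c _ c' _ hcc'
    refine Set.disjoint_left.2 fun ω h1 h2 => hcc' ?_
    exact (h1.1.2 : z 2 ω.1 = c).symm.trans h2.1.2
  · exact fun c _ => (Set.toFinite _).measurableSet
  · exact Set.iUnion₂_subset fun c _ =>
      Set.prod_mono Set.inter_subset_left Set.inter_subset_left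
  · exact (Set.toFinite _).measurableSet

end BrickSize

/-! ### Transfer of events through an isomorphism of filtrations -/

section Isomorphism

theorem L0.exists_ae_eq {Ω : Type*} {m mΩ : MeasurableSpace Ω} {μ : Measure Ω} (hm : m ≤ mΩ)
    {g : Ω → ℝ} (hg : AEStronglyMeasurable[m] g μ) : ∃ Z : L0 μ m, (Z.1 : Ω → ℝ) =ᵐ[μ] g :=
  ⟨⟨AEEqFun.mk g (hg.mono hm), hg.congr (AEEqFun.coeFn_mk g _).symm⟩, AEEqFun.coeFn_mk g _⟩

variable {ι : Type*} [Preorder ι] {Ω Ω' : Type*} {mΩ : MeasurableSpace Ω}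
  {mΩ' : MeasurableSpace Ω'} {μ : Measure Ω} {F : Filtration ι mΩ} {μ' : Measure Ω'}
  {F' : Filtration ι mΩ'}

/-- The isomorphism sends the indicator of `A` to the indicator of `A'`. -/
def FilteredIso.Corr (Ψ : FilteredIso μ F μ' F') (A : Set Ω) (A' : Set Ω') : Prop :=
  MeasurableSet A ∧ MeasurableSet A' ∧ ∃ Z : L0 μ (⨆ i, F i),
    (Z.1 : Ω → ℝ) =ᵐ[μ] A.indicator (fun _ => 1) ∧
      ((Ψ.toEquiv Z).1 : Ω' → ℝ) =ᵐ[μ'] A'.indicator (fun _ => 1)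

namespace FilteredIso

variable {Ψ : FilteredIso μ F μ' F'}

/-- Supplies the element of `L0` required by `comm_borel`: measurable versions of the `Y k` show
that `Φ` of the sequence is again measurable up to null sets. -/
theorem exists_borel (Ψ : FilteredIso μ F μ' F') (Y : ℕ → L0 μ (⨆ i, F i)) {Φ : (ℕ → ℝ) → ℝ}
    (hΦ : Measurable Φ) : ∃ Z : L0 μ (⨆ i, F i),
      (Z.1 : Ω → ℝ) =ᵐ[μ] (fun ω => Φ fun k => (Y k).1 ω) ∧
      ((Ψ.toEquiv Z).1 : Ω' → ℝ) =ᵐ[μ'] (fun ω => Φ fun k => (Ψ.toEquiv (Y k)).1 ω) := by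
  have hY : ∀ k, AEStronglyMeasurable[⨆ i, F i] ((Y k).1 : Ω → ℝ) μ := fun k => (Y k).2
  choose g hg hYg using hY
  have hgm : Measurable[⨆ i, F i] fun ω k => g k ω :=
    @measurable_pi_lambda _ _ _ (⨆ i, F i) _ _ fun k => (hg k).measurable
  have hall : ∀ᵐ ω ∂μ, ∀ k, ((Y k).1 : Ω → ℝ) ω = g k ω := ae_all_iff.2 hYg
  obtain ⟨Z, hZ⟩ := L0.exists_ae_eq (μ := μ) (iSup_le fun i => F.le i)
    (g := fun ω => Φ fun k => (Y k).1 ω) ⟨fun ω => Φ fun k => g k ω,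
      (hΦ.comp hgm).stronglyMeasurable, by
        filter_upwards [hall] with ω hω
        simp only [hω]⟩
  exact ⟨Z, hZ, Ψ.comm_borel Y Φ hΦ Z hZ⟩

theorem Corr.congr_right {A : Set Ω} {A' A'' : Set Ω'} (h : Ψ.Corr A A') (hA : A' =ᵐ[μ'] A'')
    (hm : MeasurableSet A'') : Ψ.Corr A A'' := by
  obtain ⟨h1, -, Z, h3, h4⟩ := h
  exact ⟨h1, hm, Z, h3, h4.trans (indicator_ae_eq_of_ae_eq_set hA)⟩

theorem Corr.measure_eq {A : Set Ω} {A' : Set Ω'} (h : Ψ.Corr A A') : μ' A' = μ A := by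
  obtain ⟨h1, h2, Z, h3, h4⟩ := h
  have h5 := congrArg (fun ν => ν {1}) (Ψ.law_eq Z)
  have h6 : μ'.map ((Ψ.toEquiv Z).1 : Ω' → ℝ) = μ'.map (A'.indicator fun _ => (1 : ℝ)) :=
    Measure.map_congr h4
  have h7 : μ.map (Z.1 : Ω → ℝ) = μ.map (A.indicator fun _ => (1 : ℝ)) := Measure.map_congr h3
  have h5' : (μ'.map (A'.indicator fun _ => (1 : ℝ))) {1} =
      (μ.map (A.indicator fun _ => (1 : ℝ))) {1} := by
    rw [← h6, ← h7]; exact h5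
  rw [Measure.map_apply (measurable_const.indicator h2) (measurableSet_singleton _),
    Measure.map_apply (measurable_const.indicator h1) (measurableSet_singleton _)] at h5'
  have e1 : (A'.indicator fun _ => (1 : ℝ)) ⁻¹' {1} = A' := by
    ext ω; by_cases h : ω ∈ A' <;> simp [h]
  have e2 : (A.indicator fun _ => (1 : ℝ)) ⁻¹' {1} = A := by
    ext ω; by_cases h : ω ∈ A <;> simp [h]
  rwa [e1, e2] at h5'

theorem Corr.inter {A B : Set Ω} {A' B' : Set Ω'} (hA : Ψ.Corr A A') (hB : Ψ.Corr B B') :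
    Ψ.Corr (A ∩ B) (A' ∩ B') := by
  obtain ⟨h1, h2, Z, h3, h4⟩ := hA
  obtain ⟨g1, g2, Y, g3, g4⟩ := hB
  obtain ⟨X, hX, hX'⟩ := Ψ.exists_borel (fun k => if k = 0 then Z else Y)
    (Φ := fun y => y 0 * y 1) (by fun_prop)
  refine ⟨h1.inter g1, h2.inter g2, X, ?_, ?_⟩
  · filter_upwards [hX, h3, g3] with ω a b c
    simp only [↓reduceIte, one_ne_zero] at a
    rw [a, b, c, ← Set.inter_indicator_mul]
    simp
  · filter_upwards [hX', h4, g4] with ω a b c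
    simp only [↓reduceIte, one_ne_zero] at a
    rw [a, b, c, ← Set.inter_indicator_mul]
    simp

theorem Corr.compl {A : Set Ω} {A' : Set Ω'} (hA : Ψ.Corr A A') : Ψ.Corr Aᶜ A'ᶜ := by
  classical
  obtain ⟨h1, h2, Z, h3, h4⟩ := hA
  obtain ⟨X, hX, hX'⟩ := Ψ.exists_borel (fun _ => Z) (Φ := fun y => 1 - y 0) (by fun_prop)
  refine ⟨h1.compl, h2.compl, X, ?_, ?_⟩
  · filter_upwards [hX, h3] with ω a b
    rw [a, b]
    by_cases h : ω ∈ A <;> simp [h]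
  · filter_upwards [hX', h4] with ω a b
    rw [a, b]
    by_cases h : ω ∈ A' <;> simp [h]

/-- The indicator of a countable union is a Borel function of the sequence of indicators. -/
theorem Corr.iUnion {A : ℕ → Set Ω} {A' : ℕ → Set Ω'} (hA : ∀ k, Ψ.Corr (A k) (A' k)) :
    Ψ.Corr (⋃ k, A k) (⋃ k, A' k) := by
  classical
  choose h1 h2 Z h3 h4 using hA
  have hS : MeasurableSet {y : ℕ → ℝ | ∃ k, y k = 1} := by
    have : {y : ℕ → ℝ | ∃ k, y k = 1} = ⋃ k, (fun y : ℕ → ℝ => y k) ⁻¹' {1} := by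
      ext; simp
    rw [this]
    exact MeasurableSet.iUnion fun k => measurable_pi_apply k (measurableSet_singleton _)
  obtain ⟨X, hX, hX'⟩ := Ψ.exists_borel Z
    (Φ := {y : ℕ → ℝ | ∃ k, y k = 1}.indicator fun _ => 1) (measurable_const.indicator hS)
  refine ⟨.iUnion h1, .iUnion h2, X, ?_, ?_⟩
  · filter_upwards [hX, ae_all_iff.2 h3] with ω a b
    rw [a]
    simp only [Set.indicator_apply, Set.mem_ofPred_eq, Set.mem_iUnion, b]
    simp
  · filter_upwards [hX', ae_all_iff.2 h4] with ω a b
    rw [a]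
    simp only [Set.indicator_apply, Set.mem_ofPred_eq, Set.mem_iUnion, b]
    simp

theorem exists_corr_preimage (Ψ : FilteredIso μ F μ' F') {i : ι} {Y : L0 μ (⨆ i, F i)}
    (hY : Y.1 ∈ L0 μ (F i)) {B : Set ℝ} (hB : MeasurableSet B) :
    ∃ A, MeasurableSet[F i] A ∧ Ψ.Corr A (((Ψ.toEquiv Y).1 : Ω' → ℝ) ⁻¹' B) := by
  obtain ⟨g, hg, hYg⟩ := hY
  obtain ⟨X, hX, hX'⟩ := Ψ.exists_borel (fun _ => Y) (Φ := fun y => B.indicator (fun _ => 1) (y 0))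
    ((measurable_const.indicator hB).comp (measurable_pi_apply 0))
  refine ⟨g ⁻¹' B, hg.measurable hB, F.le i _ (hg.measurable hB),
    (Ψ.toEquiv Y).1.measurable hB, X, ?_, hX'⟩
  filter_upwards [hX, hYg] with ω a b
  rw [a]
  change B.indicator (fun _ => (1 : ℝ)) ((Y.1 : Ω → ℝ) ω) = _
  rw [show (Y.1 : Ω → ℝ) ω = g ω from b]
  rfl

/-- Take for `A'` the event that the image of the indicator of `A` equals `1`; it belongs to the
σ-field that these images generate. -/
theorem exists_corr_of_mem (Ψ : FilteredIso μ F μ' F') {i : ι} {A : Set Ω}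
    (hA : MeasurableSet[F i] A) :
    ∃ A', MeasurableSet[completion μ' (F' i)] A' ∧ Ψ.Corr A A' := by
  have hsm : StronglyMeasurable[F i] (A.indicator fun _ => (1 : ℝ)) :=
    stronglyMeasurable_const.indicator hA
  obtain ⟨Z, hZ⟩ := L0.exists_ae_eq (μ := μ) (iSup_le fun i => F.le i)
    (hsm.mono (le_iSup F.seq i)).aestronglyMeasurable
  have hZi : Z.1 ∈ L0 μ (F i) := ⟨_, hsm, hZ⟩
  have hm : MeasurableSet[completion μ' (F' i)] (((Ψ.toEquiv Z).1 : Ω' → ℝ) ⁻¹' {1}) := by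
    rw [← Ψ.generate i]
    refine le_completion (iSup₂_le fun Y _ => (Ψ.toEquiv Y).1.measurable.comap_le) μ' _ ?_
    exact le_iSup₂_of_le (f := fun (Y : L0 μ (⨆ i, F i)) (_ : Y.1 ∈ L0 μ (F i)) =>
      MeasurableSpace.comap ((Ψ.toEquiv Y).1 : Ω' → ℝ) inferInstance) Z hZi le_rfl _
      ⟨{1}, measurableSet_singleton _, rfl⟩
  obtain ⟨X, hX, hX'⟩ := Ψ.exists_borel (fun _ => Z)
    (Φ := fun y => ({1} : Set ℝ).indicator (fun _ => 1) (y 0))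
    ((measurable_const.indicator (measurableSet_singleton _)).comp (measurable_pi_apply 0))
  refine ⟨_, hm, F.le i _ hA, inf_le_right (a := eventuallyMeasurableSpace _ _) _ hm, X, ?_, hX'⟩
  filter_upwards [hX, hZ] with ω a b
  rw [a]
  change ({1} : Set ℝ).indicator (fun _ => (1 : ℝ)) ((Z.1 : Ω → ℝ) ω) = _
  rw [b]
  by_cases h : ω ∈ A <;> simp [h]

/-- Events having a counterpart in `F i` form a σ-field that contains the generators of `F' i`. This
converse direction is what carries a conditional probability given `F i` over to one given `F' i`.
-/
theorem exists_corr_of_mem_right (Ψ : FilteredIso μ F μ' F') {i : ι} {A' : Set Ω'}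
    (hA' : MeasurableSet[F' i] A') : ∃ A, MeasurableSet[F i] A ∧ Ψ.Corr A A' := by
  have h0 : Ψ.Corr ∅ ∅ := by
    obtain ⟨X, hX, hX'⟩ := Ψ.exists_borel (fun _ => Classical.choice
      (let ⟨Z, _⟩ := L0.exists_ae_eq (μ := μ) (iSup_le fun i => F.le i)
        (stronglyMeasurable_const (b := (0 : ℝ))).aestronglyMeasurable; ⟨Z⟩))
      (Φ := fun _ => 0) measurable_const
    refine ⟨.empty, .empty, X, ?_, ?_⟩
    · simpa using hX
    · simpa using hX'
  let m : MeasurableSpace Ω' :=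
    { MeasurableSet' := fun A' => ∃ A, MeasurableSet[F i] A ∧ Ψ.Corr A A'
      measurableSet_empty := ⟨∅, @MeasurableSet.empty _ (F i), h0⟩
      measurableSet_compl := fun A' ⟨A, h1, h2⟩ => ⟨Aᶜ, @MeasurableSet.compl _ _ (F i) h1, h2.compl⟩
      measurableSet_iUnion := fun A' h => by
        choose A h1 h2 using h
        exact ⟨⋃ k, A k, @MeasurableSet.iUnion _ _ (F i) _ _ h1, Corr.iUnion h2⟩ }
  have hm : MeasurableSet[completion μ' (F' i)] A' := le_completion (F'.le i) μ' _ hA'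
  rw [← Ψ.generate i] at hm
  obtain ⟨⟨t, ht, hst⟩, hA'm⟩ := measurableSet_completion_iff.1 hm
  have hle : (⨆ (Y : L0 μ (⨆ i, F i)) (_ : Y.1 ∈ L0 μ (F i)),
      MeasurableSpace.comap ((Ψ.toEquiv Y).1 : Ω' → ℝ) inferInstance) ≤ m := by
    refine iSup₂_le fun Y hY => ?_
    rintro _ ⟨B, hB, rfl⟩
    exact Ψ.exists_corr_preimage hY hB
  obtain ⟨A, hA, hAt⟩ := hle t ht
  exact ⟨A, hA, hAt.congr_right hst.symm hA'm⟩

end FilteredIso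

end Isomorphism

/-! ### Realization of a standard process on independent coordinates -/

section Representation

theorem FilteredIso.Corr.iUnion_countable {ι : Type*} [Preorder ι] {Ω Ω' : Type*}
    {mΩ : MeasurableSpace Ω} {mΩ' : MeasurableSpace Ω'} {μ : Measure Ω} {F : Filtration ι mΩ}
    {μ' : Measure Ω'} {F' : Filtration ι mΩ'} {Ψ : FilteredIso μ F μ' F'} {κ : Type*}
    [Countable κ] [Nonempty κ] {A : κ → Set Ω} {A' : κ → Set Ω'}
    (hA : ∀ k, Ψ.Corr (A k) (A' k)) : Ψ.Corr (⋃ k, A k) (⋃ k, A' k) := by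
  obtain ⟨e, he⟩ := exists_surjective_nat κ
  rw [← he.iUnion_comp, ← he.iUnion_comp]
  exact FilteredIso.Corr.iUnion fun n => hA (e n)

theorem FilteredIso.Corr.iInter_countable {ι : Type*} [Preorder ι] {Ω Ω' : Type*}
    {mΩ : MeasurableSpace Ω} {mΩ' : MeasurableSpace Ω'} {μ : Measure Ω} {F : Filtration ι mΩ}
    {μ' : Measure Ω'} {F' : Filtration ι mΩ'} {Ψ : FilteredIso μ F μ' F'} {κ : Type*}
    [Countable κ] [Nonempty κ] {A : κ → Set Ω} {A' : κ → Set Ω'}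
    (hA : ∀ k, Ψ.Corr (A k) (A' k)) : Ψ.Corr (⋂ k, A k) (⋂ k, A' k) := by
  have := (FilteredIso.Corr.iUnion_countable fun k => (hA k).compl).compl
  simpa only [Set.compl_iUnion, compl_compl] using this

/-- Glues events that almost surely form a partition into one random variable. The index of the cell
is coded as a natural number, from which every map is measurable. -/
theorem exists_measurable_preimage_ae_eq {W : Type*} {H mW : MeasurableSpace W} {π : Measure W}
    {A : Type*} [Finite A] [Nonempty A] [MeasurableSpace A] {B : A → Set W}
    (hB : ∀ a, MeasurableSet[H] (B a)) (h : ∀ᵐ w ∂π, ∃! a, w ∈ B a) :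
    ∃ f : W → A, Measurable[H] f ∧ ∀ a, f ⁻¹' {a} =ᵐ[π] B a := by
  classical
  cases nonempty_fintype A
  obtain ⟨a₀⟩ := ‹Nonempty A›
  let e := Fintype.equivFin A
  -- The value `a₀` serves only sums of indices that are out of range, which occur on a null set.
  let dec : ℕ → A := fun n => if hn : n < Fintype.card A then e.symm ⟨n, hn⟩ else a₀
  have hdec : ∀ a, dec (e a) = a := fun a => by simp [dec]
  let h' : W → ℕ := fun w => ∑ a, (B a).indicator (fun _ => (e a : ℕ)) w
  have mh' : Measurable[H] h' :=
    Finset.measurable_sum (m := H) _ fun a _ => measurable_const.indicator (hB a)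
  refine ⟨dec ∘ h', (measurable_from_nat (f := dec)).comp mh', fun a => ?_⟩
  filter_upwards [h] with w ⟨a₁, h1, h2⟩
  have hw : h' w = e a₁ := by
    simp only [h']
    rw [Finset.sum_eq_single a₁]
    · simp [h1]
    · intro b _ hb
      exact Set.indicator_of_notMem (fun hwb => hb (h2 b hwb)) _
    · simp
  refine propext ?_
  change dec (h' w) = a ↔ w ∈ B a
  rw [hw, hdec]
  exact ⟨fun hh => hh ▸ h1, fun hh => (h2 a hh).symm⟩

/-- The σ-field on `ι → ℝ` generated by the coordinates up to `i`. -/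
@[reducible]
def coordField {ι : Type*} [Preorder ι] (i : ι) : MeasurableSpace (ι → ℝ) :=
  ⨆ j ≤ i, MeasurableSpace.comap (fun w : ι → ℝ => w j) inferInstance

theorem coordField_le {ι : Type*} [Preorder ι] (i : ι) : coordField i ≤ MeasurableSpace.pi :=
  iSup_comap_le (fun j => measurable_pi_apply j) i

theorem coordField_mono {ι : Type*} [Preorder ι] : Monotone (coordField (ι := ι)) :=
  fun _ _ hij => biSup_mono fun _ h => h.trans hij

/-- A finite-valued Markov process whose natural filtration is standard can be realized, on a
product of probability measures on the real line, as a process which is adapted to the coordinate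
filtration and has the same transition probabilities with respect to this filtration. -/
theorem IsStandard.exists_representation {ι : Type*} [Preorder ι] {Ω : Type u}
    {mΩ : MeasurableSpace Ω} {μ : Measure Ω} [IsProbabilityMeasure μ] {E : ι → Type w}
    [∀ n, Finite (E n)] [∀ n, MeasurableSpace (E n)] [∀ n, MeasurableSingletonClass (E n)]
    {X : (n : ι) → Ω → E n} (hX : ∀ n, Measurable (X n)) {p : (i j : ι) → E i → E j → ℝ≥0}
    (hp : ∀ i j, i ⋖ j → ∀ a b,
      HasCondProb μ (naturalFiltration μ X i) (X i ⁻¹' {a}) (X j ⁻¹' {b}) (p i j a b))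
    (hstd : IsStandard.{u, v} μ (naturalFiltration μ X)) :
    ∃ (ν : ι → Measure ℝ) (_ : ∀ n, IsProbabilityMeasure (ν n)) (f : (n : ι) → (ι → ℝ) → E n),
      (∀ n, Measurable[coordField n] (f n)) ∧
      (∀ {κ : Type} [Countable κ] [Nonempty κ] (t : κ → ι) (a : (k : κ) → E (t k)),
        Measure.infinitePi ν (⋂ k, f (t k) ⁻¹' {a k}) = μ (⋂ k, X (t k) ⁻¹' {a k})) ∧
      ∀ i j, i ⋖ j → ∀ a b,
        HasCondProb (Measure.infinitePi ν) (coordField i) (f i ⁻¹' {a}) (f j ⁻¹' {b})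
          (p i j a b) := by
  obtain ⟨Ω', mΩ', μ', F', G', hprob, ⟨Ψ⟩, ⟨V, mV, hV, rfl⟩, him⟩ := hstd
  have hne : ∀ n, Nonempty (E n) := fun n => (μ.nonempty_of_neZero).map (X n)
  let φ : Ω' → ι → ℝ := fun ω i => V i ω
  have mφ : Measurable φ := measurable_pi_lambda _ mV
  have hlaw : μ'.map φ = Measure.infinitePi fun i => μ'.map (V i) :=
    hV.map_fun_eq_infinitePi_map mV
  have hνp : ∀ i, IsProbabilityMeasure (μ'.map (V i)) :=
    fun i => Measure.isProbabilityMeasure_map (mV i).aemeasurable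
  have hXn : ∀ n a, MeasurableSet[naturalFiltration μ X n] (X n ⁻¹' {a}) := fun n a =>
    comap_le_naturalFiltration hX μ le_rfl _ ⟨{a}, measurableSet_singleton a, rfl⟩
  -- Three versions of one event: `{X n = a}` on the original space, its counterpart `s` in `F' n`,
  -- and, since `F' n` is contained in the product-type filtration, an event `B` of the coordinates
  -- up to `n`.
  have hA : ∀ n a, ∃ s, MeasurableSet[F' n] s ∧ ∃ B, MeasurableSet[coordField n] B ∧
      s =ᵐ[μ'] (φ ⁻¹' B : Set Ω') ∧ Ψ.Corr (X n ⁻¹' {a}) (φ ⁻¹' B) := by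
    intro n a
    obtain ⟨A', hA', hc⟩ := Ψ.exists_corr_of_mem (hXn n a)
    obtain ⟨⟨s, hs, hAs⟩, -⟩ := measurableSet_completion_iff.1 hA'
    obtain ⟨⟨t, ht, hst⟩, -⟩ := measurableSet_completion_iff.1 (him.1 n s hs)
    have hcomap : (⨆ j ≤ n, MeasurableSpace.comap (V j) inferInstance) ≤
        MeasurableSpace.comap φ (coordField n) := by
      simp only [coordField, MeasurableSpace.comap_iSup, MeasurableSpace.comap_comp]
      exact le_rfl
    obtain ⟨B, hB, rfl⟩ := hcomap t ht
    exact ⟨s, hs, B, hB, hst, hc.congr_right (hAs.trans hst) (mφ (coordField_le n _ hB))⟩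
  choose s hs B hB hsB hc using hA
  have hBπ : ∀ n a, MeasurableSet (B n a) := fun n a => coordField_le n _ (hB n a)
  -- The correspondence preserves intersections, unions, complements and measures, so the events `B
  -- n a` inherit from `{X n = a}` the partition property up to null sets.
  have huniq : ∀ n, ∀ᵐ w ∂(Measure.infinitePi fun i => μ'.map (V i)), ∃! a, w ∈ B n a := by
    intro n
    rw [← hlaw]
    have h1 : ∀ᵐ w ∂(μ'.map φ), ∀ a b, a ≠ b → ¬ (w ∈ B n a ∧ w ∈ B n b) := by
      simp only [ae_all_iff]
      intro a b hab
      rw [ae_iff]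
      simp only [not_not]
      change (μ'.map φ) (B n a ∩ B n b) = 0
      rw [Measure.map_apply mφ ((hBπ n a).inter (hBπ n b)), Set.preimage_inter,
        ((hc n a).inter (hc n b)).measure_eq, ← Set.preimage_inter]
      rw [Set.singleton_inter_eq_empty.2 (by simpa using hab)]
      simp
    have h2 : ∀ᵐ w ∂(μ'.map φ), ∃ a, w ∈ B n a := by
      rw [ae_iff]
      have e1 : {w | ¬ ∃ a, w ∈ B n a} = (⋃ a, B n a)ᶜ := by ext; simp
      have e2 : (⋃ a, X n ⁻¹' {a}) = Set.univ := by ext; simp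
      rw [e1, Measure.map_apply mφ (MeasurableSet.iUnion (hBπ n)).compl, Set.preimage_compl,
        Set.preimage_iUnion, (FilteredIso.Corr.iUnion_countable (hc n)).compl.measure_eq, e2]
      simp
    filter_upwards [h1, h2] with w hw ⟨a, ha⟩
    exact ⟨a, ha, fun b hb => by_contra fun hab => hw b a hab ⟨hb, ha⟩⟩
  choose f mf hf using fun n => exists_measurable_preimage_ae_eq (hB n) (huniq n)
  have mf' : ∀ n a, MeasurableSet (f n ⁻¹' {a}) := fun n a =>
    coordField_le n _ (mf n (measurableSet_singleton a))
  have hBf : ∀ n a, (φ ⁻¹' B n a : Set Ω') =ᵐ[μ'] (φ ⁻¹' (f n ⁻¹' {a}) : Set Ω') := by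
    intro n a
    refine Measure.QuasiMeasurePreserving.preimage_ae_eq (μb := μ'.map φ)
      ⟨mφ, Measure.AbsolutelyContinuous.rfl⟩ ?_
    rw [hlaw]
    exact (hf n a).symm
  have hcf : ∀ n a, Ψ.Corr (X n ⁻¹' {a}) (φ ⁻¹' (f n ⁻¹' {a})) := fun n a =>
    (hc n a).congr_right (hBf n a) (mφ (mf' n a))
  refine ⟨fun i => μ'.map (V i), hνp, f, mf, ?_, ?_⟩
  · intro κ _ _ t a
    rw [← hlaw, Measure.map_apply mφ (.iInter fun k => mf' _ _), Set.preimage_iInter]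
    exact (FilteredIso.Corr.iInter_countable fun k => hcf (t k) (a k)).measure_eq
  · intro i j hij a b
    rw [← hlaw]
    have h1 : HasCondProb μ' (F' i) (s i a) (s j b) (p i j a b) := by
      refine HasCondProb.congr (s := φ ⁻¹' (f i ⁻¹' {a})) (u := φ ⁻¹' (f j ⁻¹' {b})) ?_
        ((hsB i a).trans (hBf i a)).symm ((hsB j b).trans (hBf j b)).symm
      intro t ht
      obtain ⟨T, hT, hTt⟩ := Ψ.exists_corr_of_mem_right ht
      rw [((hTt.inter (hcf i a)).inter (hcf j b)).measure_eq, (hTt.inter (hcf i a)).measure_eq]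
      exact hp i j hij a b T hT
    -- Immersion is used here: the transition probability given `F' i` stays valid given the larger
    -- product-type σ-field.
    have h2 := (him.2 i j hij).hasCondProb (F'.le i) (F'.le j)
      ((naturalFiltration μ' V).le i) (hs i a) (hs j b) h1
    refine HasCondProb.map mφ (h2.congr ((hsB i a).trans (hBf i a))
      ((hsB j b).trans (hBf j b))) (coordField_le i) (mf' i a) (mf' j b) fun t ht => ?_
    have h3 : @Measurable _ _ (⨆ j ≤ i, MeasurableSpace.comap (V j) inferInstance)
        (coordField i) φ :=
      measurable_to_iSup_comap _ fun j hj => measurable_iSup_comap V hj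
    exact le_completion (iSup_comap_le mV i) μ' _ (h3 ht)

end Representation

/-! ### Mixing two independent families of coordinates -/

section Coupling

variable {ι : Type*} [LinearOrder ι]

/-- Exchange the coordinates up to `n` of two families. -/
def swapBelow (n : ι) (x : (ι → ℝ) × (ι → ℝ)) : (ι → ℝ) × (ι → ℝ) :=
  (fun i => if i ≤ n then x.2 i else x.1 i, fun i => if i ≤ n then x.1 i else x.2 i)

theorem swapBelow_swapBelow (n : ι) (x : (ι → ℝ) × (ι → ℝ)) :
    swapBelow n (swapBelow n x) = x := by
  refine Prod.ext (funext fun i => ?_) (funext fun i => ?_) <;>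
  · by_cases h : i ≤ n <;> simp [swapBelow, h]

/-- The product σ-field of the coordinates up to `k` in two families. -/
@[reducible]
def coordField₂ (k : ι) : MeasurableSpace ((ι → ℝ) × (ι → ℝ)) :=
  @Prod.instMeasurableSpace _ _ (coordField k) (coordField k)

theorem coordField₂_le (k : ι) : coordField₂ k ≤ Prod.instMeasurableSpace :=
  sup_le_sup (MeasurableSpace.comap_mono (coordField_le k))
    (MeasurableSpace.comap_mono (coordField_le k))

theorem coordField₂_mono : Monotone (coordField₂ (ι := ι)) := fun _ _ h =>
  sup_le_sup (MeasurableSpace.comap_mono (coordField_mono h))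
    (MeasurableSpace.comap_mono (coordField_mono h))

theorem measurable_swapBelow_coordField₂ (n k : ι) :
    Measurable[coordField₂ k, coordField₂ k] (swapBelow n) := by
  have h1 : ∀ j ≤ k, Measurable[coordField₂ k] fun x : (ι → ℝ) × (ι → ℝ) => x.1 j :=
    fun j hj => (measurable_iSup_comap (fun (j : ι) (w : ι → ℝ) => w j) hj).comp
      (@measurable_fst _ _ (coordField k) (coordField k))
  have h2 : ∀ j ≤ k, Measurable[coordField₂ k] fun x : (ι → ℝ) × (ι → ℝ) => x.2 j :=
    fun j hj => (measurable_iSup_comap (fun (j : ι) (w : ι → ℝ) => w j) hj).comp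
      (@measurable_snd _ _ (coordField k) (coordField k))
  refine @Measurable.prodMk _ (coordField₂ k) _ _ (coordField k) (coordField k) _ _ ?_ ?_ <;>
  · refine measurable_to_iSup_comap _ fun j hj => ?_
    by_cases h : j ≤ n
    · simpa [Function.comp_def, h] using by first | exact h2 j hj | exact h1 j hj
    · simpa [Function.comp_def, h] using by first | exact h1 j hj | exact h2 j hj

theorem measurable_swapBelow (n : ι) : Measurable (swapBelow n) := by
  refine Measurable.prodMk ?_ ?_ <;>
  · refine measurable_pi_lambda _ fun i => ?_
    by_cases h : i ≤ n <;> simp only [h, if_true, if_false] <;> fun_prop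

theorem pi_eq_pi_union_left (I J : Finset ι) (s : ι → Set ℝ) :
    (I : Set ι).pi s = ((I ∪ J : Finset ι) : Set ι).pi fun i => if i ∈ I then s i else Set.univ := by
  ext w
  simp only [Set.mem_pi, Finset.mem_coe, Finset.mem_union]
  refine ⟨fun h i _ => ?_, fun h i hi => by simpa [hi] using h i (Or.inl hi)⟩
  by_cases hi : i ∈ I
  · simpa [hi] using h i hi
  · simp [hi]

/-- The mass of a product of two boxes is a product over coordinates `i` of two factors taken with
the same measure `ν i`; the swap merely exchanges those two factors for `i ≤ n`. -/
theorem measurePreserving_swapBelow (ν : ι → Measure ℝ) [∀ i, IsProbabilityMeasure (ν i)] (n : ι) :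
    MeasurePreserving (swapBelow n) ((Measure.infinitePi ν).prod (Measure.infinitePi ν))
      ((Measure.infinitePi ν).prod (Measure.infinitePi ν)) := by
  refine ⟨measurable_swapBelow n, Eq.symm ?_⟩
  have hspan : (Measure.infinitePi ν).FiniteSpanningSetsIn
      (squareCylinders fun _ : ι => {s : Set ℝ | MeasurableSet s}) :=
    ⟨fun _ => Set.univ, fun _ => ⟨∅, fun _ => Set.univ, by simp, by simp⟩,
      fun _ => measure_lt_top _ _, Set.iUnion_const _⟩
  have hpi : IsPiSystem (squareCylinders fun _ : ι => {s : Set ℝ | MeasurableSet s}) :=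
    isPiSystem_squareCylinders (fun _ => MeasurableSpace.isPiSystem_measurableSet) (by simp)
  refine Measure.prod_eq_generateFrom generateFrom_squareCylinders generateFrom_squareCylinders
    hpi hpi hspan hspan ?_
  have key : ∀ (K : Finset ι) (s t : ι → Set ℝ), (∀ i, MeasurableSet (s i)) →
      (∀ i, MeasurableSet (t i)) →
      ((Measure.infinitePi ν).prod (Measure.infinitePi ν)).map (swapBelow n)
        ((K : Set ι).pi s ×ˢ (K : Set ι).pi t) =
      Measure.infinitePi ν ((K : Set ι).pi s) * Measure.infinitePi ν ((K : Set ι).pi t) := by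
    intro K s t hs ht
    have hK : ∀ r : ι → Set ℝ, (∀ i, MeasurableSet (r i)) → MeasurableSet ((K : Set ι).pi r) :=
      fun r hr => .pi K.countable_toSet fun i _ => hr i
    have e : swapBelow n ⁻¹' ((K : Set ι).pi s ×ˢ (K : Set ι).pi t) =
        (K : Set ι).pi (fun i => if i ≤ n then t i else s i) ×ˢ
          (K : Set ι).pi (fun i => if i ≤ n then s i else t i) := by
      ext x
      simp only [swapBelow, Set.mem_preimage, Set.mem_prod, Set.mem_pi]
      rw [← forall₂_and, ← forall₂_and]
      refine forall₂_congr fun i _ => ?_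
      by_cases h : i ≤ n <;> simp [h, and_comm]
    rw [Measure.map_apply (measurable_swapBelow n) ((hK s hs).prod (hK t ht)), e,
      Measure.prod_prod, Measure.infinitePi_pi, Measure.infinitePi_pi, Measure.infinitePi_pi,
      Measure.infinitePi_pi, ← Finset.prod_mul_distrib, ← Finset.prod_mul_distrib]
    · refine Finset.prod_congr rfl fun i _ => ?_
      by_cases h : i ≤ n <;> simp [h, mul_comm]
    all_goals
      intro i _
      first | exact hs i | exact ht i | (split_ifs <;> first | exact hs i | exact ht i)
  rintro _ ⟨I, s, hs, rfl⟩ _ ⟨J, t, ht, rfl⟩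
  -- Both boxes are put over the same finite set of coordinates, so that the swap acts factor by
  -- factor.
  rw [pi_eq_pi_union_left I J s, pi_eq_pi_union_left J I t, Finset.union_comm J I]
  refine key _ _ _ (fun i => ?_) (fun i => ?_)
  · split_ifs
    · exact hs i trivial
    · exact .univ
  · split_ifs
    · exact ht i trivial
    · exact .univ

/-- The swap is an involution that preserves both the measure and each `coordField₂ k`. Pulled back
by it, the claim for the mixed family becomes the claim for the first family, which is
`HasCondProb.prod_fst`. -/
theorem HasCondProb.comp_swapBelow {ν : ι → Measure ℝ} [∀ i, IsProbabilityMeasure (ν i)] (n : ι)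
    {k : ι} {s u : Set (ι → ℝ)} {p : ℝ≥0} (hs : MeasurableSet s) (hu : MeasurableSet u)
    (h : HasCondProb (Measure.infinitePi ν) (coordField k) s u p) :
    HasCondProb ((Measure.infinitePi ν).prod (Measure.infinitePi ν)) (coordField₂ k)
      ((Prod.fst ∘ swapBelow n) ⁻¹' s) ((Prod.fst ∘ swapBelow n) ⁻¹' u) p := by
  rw [← (measurePreserving_swapBelow ν n).map_eq]
  refine HasCondProb.map (measurable_swapBelow n)
    (H := coordField₂ k) ?_ (coordField₂_le k)
    (measurable_fst.comp (measurable_swapBelow n) hs)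
    (measurable_fst.comp (measurable_swapBelow n) hu)
    fun t ht => measurable_swapBelow_coordField₂ n k ht
  have e : ∀ r : Set (ι → ℝ), swapBelow n ⁻¹' ((Prod.fst ∘ swapBelow n) ⁻¹' r) =
      Prod.fst ⁻¹' r := by
    intro r
    ext x
    simp [swapBelow_swapBelow]
  rw [e, e]
  exact h.prod_fst (coordField_le k) (coordField_le k)

/-- The sets that do not separate `w` from `w'` form a σ-field containing the generators. -/
theorem mem_iff_of_measurableSet_coordField {n : ι} {s : Set (ι → ℝ)}
    (hs : MeasurableSet[coordField n] s) {w w' : ι → ℝ} (h : ∀ j ≤ n, w j = w' j) :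
    w ∈ s ↔ w' ∈ s := by
  let m : MeasurableSpace (ι → ℝ) :=
    { MeasurableSet' := fun s => w ∈ s ↔ w' ∈ s
      measurableSet_empty := Iff.rfl
      measurableSet_compl := fun s hs => not_congr hs
      measurableSet_iUnion := fun f hf => by
        simp only [Set.mem_iUnion]
        exact exists_congr hf }
  have hle : coordField n ≤ m := by
    refine iSup₂_le fun j hj => ?_
    rintro _ ⟨B, -, rfl⟩
    change w j ∈ B ↔ w' j ∈ B
    rw [h j hj]
  exact hle s hs

theorem preimage_fst_swapBelow {n : ι} {s : Set (ι → ℝ)} (hs : MeasurableSet[coordField n] s) :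
    (Prod.fst ∘ swapBelow n) ⁻¹' s = Prod.snd ⁻¹' s := by
  ext x
  exact mem_iff_of_measurableSet_coordField hs fun j hj => by simp [swapBelow, hj]

/-- A random variable depends little on the coordinates in the remote past. -/
theorem eventually_measure_preimage_diff_lt [NoMinOrder ι] (ν : ι → Measure ℝ)
    [∀ i, IsProbabilityMeasure (ν i)] {s : Set (ι → ℝ)} (hs : MeasurableSet s) {ε : ℝ≥0∞}
    (hε : 0 < ε) :
    ∀ᶠ n in atBot, ((Measure.infinitePi ν).prod (Measure.infinitePi ν))
      (Prod.fst ⁻¹' s \ (Prod.fst ∘ swapBelow n) ⁻¹' s) < ε := by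
  have hε2 : 0 < ε / 2 := ENNReal.half_pos hε.ne'
  obtain ⟨t, ht, hts⟩ := exists_measure_symmDiff_lt_of_generateFrom_isSetRing
    (μ := Measure.infinitePi ν) (isSetRing_measurableCylinders (α := fun _ : ι => ℝ))
    ⟨{Set.univ}, by simp, by
      simpa using univ_mem_measurableCylinders fun _ : ι => ℝ, by simp⟩
    generateFrom_measurableCylinders.symm hs hε2
  have htm : MeasurableSet t := MeasurableSet.of_mem_measurableCylinders ht
  obtain ⟨I, S, -, rfl⟩ := (mem_measurableCylinders t).1 ht
  -- Once `n` is below the finite base `I` of the approximating cylinder, mixing up to `n` does not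
  -- affect the cylinder. The error is then at most twice that of the approximation, whence `ε / 2`.
  have hI : ∀ᶠ n in atBot, ∀ i ∈ I, n < i :=
    (Filter.eventually_all_finset I).2 fun i _ => eventually_lt_atBot i
  filter_upwards [hI] with n hn
  set P := (Measure.infinitePi ν).prod (Measure.infinitePi ν)
  set D := symmDiff (cylinder I S) s
  have hD : MeasurableSet D := htm.symmDiff hs
  have hcyl : ∀ x, (swapBelow n x).1 ∈ cylinder I S ↔ x.1 ∈ cylinder I S := by
    intro x
    have : I.restrict (swapBelow n x).1 = I.restrict x.1 := by
      funext i
      simp [swapBelow, (hn i i.2).not_ge]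
    simp only [mem_cylinder, this]
  have hsub : (Prod.fst ⁻¹' s \ (Prod.fst ∘ swapBelow n) ⁻¹' s : Set ((ι → ℝ) × (ι → ℝ))) ⊆
      Prod.fst ⁻¹' D ∪ (Prod.fst ∘ swapBelow n) ⁻¹' D := by
    rintro x ⟨h1, h2⟩
    by_cases h : x.1 ∈ cylinder I S
    · exact Or.inr (Or.inl ⟨(hcyl x).2 h, h2⟩)
    · exact Or.inl (Or.inr ⟨h1, h⟩)
  have hfst : MeasurePreserving Prod.fst P (Measure.infinitePi ν) := measurePreserving_fst
  calc P _ ≤ P (Prod.fst ⁻¹' D) + P ((Prod.fst ∘ swapBelow n) ⁻¹' D) :=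
        (measure_mono hsub).trans (measure_union_le _ _)
    _ = Measure.infinitePi ν D + Measure.infinitePi ν D := by
        rw [hfst.measure_preimage hD.nullMeasurableSet,
          (hfst.comp (measurePreserving_swapBelow ν n)).measure_preimage hD.nullMeasurableSet]
    _ < ε / 2 + ε / 2 := ENNReal.add_lt_add hts hts
    _ = ε := ENNReal.add_halves ε

end Coupling

/-! ### Propagation of disagreement and the two conclusions -/

section Main

/-- Beyond an index `K` where the tail sum is below `1/2`, the inequality `∏ (1 - β) ≥ 1 - ∑ β`
keeps the product above `1/2`; the first `K` factors contribute a fixed positive constant. -/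
theorem exists_pos_le_prod_one_sub {β : ℕ → ℝ} (hβ : ∀ k, β k ∈ Set.Ioo (0 : ℝ) 1)
    (hsum : Summable β) : ∃ c > 0, ∀ N, c ≤ ∏ k ∈ Finset.range N, (1 - β k) := by
  obtain ⟨K, hK⟩ : ∃ K, ∑' k, β (k + K) < 1 / 2 :=
    ((tendsto_sum_nat_add β).eventually_lt_const (by norm_num)).exists
  have hpos : ∀ k, 0 < 1 - β k := fun k => sub_pos.2 (hβ k).2
  have h1 : ∀ N, 1 - ∑ k ∈ Finset.range N, β (k + K) ≤
      ∏ k ∈ Finset.range N, (1 - β (k + K)) := by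
    intro N
    induction N with
    | zero => simp
    | succ N ih =>
      rw [Finset.sum_range_succ, Finset.prod_range_succ]
      have h2 : ∏ k ∈ Finset.range N, (1 - β (k + K)) ≤ 1 :=
        Finset.prod_le_one (fun k _ => (hpos _).le) fun k _ => by linarith [(hβ (k + K)).1]
      nlinarith [(hβ (N + K)).1]
  refine ⟨(∏ k ∈ Finset.range K, (1 - β k)) * (1 / 2),
    mul_pos (Finset.prod_pos fun k _ => hpos k) (by norm_num), fun N => ?_⟩
  have h3 : ∏ k ∈ Finset.range (K + N), (1 - β k) ≤ ∏ k ∈ Finset.range N, (1 - β k) := by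
    rw [add_comm, Finset.prod_range_add]
    exact mul_le_of_le_one_right (Finset.prod_nonneg fun k _ => (hpos k).le)
      (Finset.prod_le_one (fun k _ => (hpos _).le) fun k _ => by linarith [(hβ (N + k)).1])
  refine le_trans ?_ h3
  rw [Finset.prod_range_add]
  refine mul_le_mul_of_nonneg_left ?_ (Finset.prod_nonneg fun k _ => (hpos k).le)
  have h4 : ∑ k ∈ Finset.range N, β (k + K) ≤ ∑' k, β (k + K) :=
    ((summable_nat_add_iff K).2 hsum).sum_le_tsum _ fun k _ => (hβ _).1.le
  have h5 := h1 N
  simp only [add_comm K]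
  linarith

theorem NonposInt.noMinOrder : NoMinOrder NonposInt :=
  ⟨fun a => ⟨⟨a.1 - 1, by have := a.2; omega⟩, Subtype.mk_lt_mk.2 (by simp)⟩⟩

theorem NonposInt.brickTime_covBy (n : NonposInt) {i j : Fin 3} (h : i ⋖ j) :
    n.brickTime i ⋖ n.brickTime j := by
  have hij : (i : ℕ) + 1 = j := by
    have h1 := h.1
    have h2 : ¬ ((i : ℕ) + 1 < j) := fun h3 =>
      h.2 (c := ⟨i + 1, h3.trans j.2⟩) (Fin.lt_def.2 (Nat.lt_succ_self _)) (Fin.lt_def.2 h3)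
    have := Fin.lt_def.1 h1
    omega
  refine ⟨Subtype.mk_lt_mk.2 (by omega), fun c h1 h2 => ?_⟩
  have h1' := Subtype.mk_lt_mk.1 h1
  have h2' : c.1 < 2 * n.1 - 2 + (j : ℕ) := h2
  have h1'' : 2 * n.1 - 2 + (i : ℕ) < c.1 := h1
  omega

theorem NonposInt.brickTime_mono (n : NonposInt) : Monotone n.brickTime := fun i j h => by
  have : (i : ℕ) ≤ j := h
  exact Subtype.mk_le_mk.2 (by omega)

theorem NonposInt.brickTime_two (n : NonposInt) : n.brickTime 2 = n.double :=
  Subtype.ext (by simp [brickTime, double])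

/-- The opposite of a natural number. -/
def NonposInt.neg (k : ℕ) : NonposInt := ⟨-k, by omega⟩

theorem NonposInt.brickTime_neg_zero (k : ℕ) :
    (neg k).brickTime 0 = (neg (k + 1)).double :=
  Subtype.ext (by simp [brickTime, double, neg]; ring)

theorem NonposInt.brickTime_zero (n : NonposInt) :
    ∃ m : NonposInt, n.brickTime 0 = m.double :=
  ⟨⟨n.1 - 1, by have := n.2; omega⟩, Subtype.ext (by simp [brickTime, double]; ring)⟩

theorem not_isStandard_naturalFiltration {Ω : Type u} {mΩ : MeasurableSpace Ω} (μ : Measure Ω)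
    [IsProbabilityMeasure μ] (F : NonposInt → Type w) [∀ n, Fintype (F n)]
    [∀ n, MeasurableSpace (F n)] [∀ n, MeasurableSingletonClass (F n)]
    (X : (n : NonposInt) → Ω → F n) (hX : ∀ n, IsUniformRV μ (X n))
    (α : NonposInt → ℝ) (hα : ∀ n, α n ∈ Set.Ioo (0 : ℝ) 1) (hαsum : Summable α)
    (hF : ∀ n : NonposInt, Fintype.card (F n.double) ≠ 1) (hMarkov : IsMarkov μ X)
    (hbrick : ∀ n : NonposInt, IsTsirelsonBrick μ (α n) fun k : Fin 3 => X (n.brickTime k)) :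
    ¬ IsStandard.{u, v} μ (naturalFiltration μ X) := by
  classical
  have := NonposInt.noMinOrder
  intro hstd
  have mX : ∀ n, Measurable (X n) := fun n => (hX n).1
  obtain ⟨p, hp⟩ := hMarkov.exists_transition mX
  obtain ⟨ν, hν, f, mf, hlaw, htr⟩ := hstd.exists_representation mX hp
  set π := Measure.infinitePi ν
  set P := π.prod π
  have mf' : ∀ n, Measurable (f n) := fun n => (mf n).mono (coordField_le n) le_rfl
  let g : (m n : NonposInt) → (NonposInt → ℝ) × (NonposInt → ℝ) → F n :=
    fun m n => f n ∘ Prod.fst ∘ swapBelow m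
  -- `d m n` is the probability that the two copies, independent up to time `m` and sharing their
  -- noise afterwards, differ at time `n`.
  let d : NonposInt → NonposInt → ℝ := fun m n => P.real {x | f n x.1 ≠ g m n x}
  -- At the mixing time itself, the second copy depends only on the second family of coordinates, so
  -- the copies are independent and uniform.
  have hstart : ∀ n, 1 - (Fintype.card (F n) : ℝ)⁻¹ = d n n := by
    intro n
    have hN : (0 : ℝ) < Fintype.card (F n) := by
      have : Nonempty (F n) := (μ.nonempty_of_neZero).map (X n)
      exact_mod_cast Fintype.card_pos
    have hpa : ∀ a, π.real (f n ⁻¹' {a}) = (Fintype.card (F n) : ℝ)⁻¹ := by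
      intro a
      rw [← (hX n).measureReal_preimage_singleton a]
      have := hlaw (κ := Unit) (fun _ => n) (fun _ => a)
      rw [Set.iInter_const, Set.iInter_const] at this
      exact congrArg ENNReal.toReal this
    have e : {x : (NonposInt → ℝ) × (NonposInt → ℝ) | f n x.1 ≠ g n n x} =
        (⋃ a ∈ (Finset.univ : Finset (F n)), (f n ⁻¹' {a}) ×ˢ (f n ⁻¹' {a}))ᶜ := by
      ext x
      have h1 : g n n x = f n x.2 := (Set.ext_iff.1
        (preimage_fst_swapBelow (mf n (measurableSet_singleton (f n x.2)))) x).2 rfl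
      rw [Set.mem_ofPred_eq, h1]
      simp [eq_comm]
    have hm : ∀ a, MeasurableSet (f n ⁻¹' {a}) := fun a => mf' n (measurableSet_singleton a)
    change _ = P.real _
    rw [e, probReal_compl_eq_one_sub (Finset.measurableSet_biUnion _ fun a _ => (hm a).prod (hm a)),
      measureReal_biUnion_finset]
    · simp only [P, measureReal_prod_prod, hpa, Finset.sum_const, Finset.card_univ, nsmul_eq_mul]
      field_simp
    · intro a _ b _ hab
      refine Set.disjoint_left.2 fun x h1 h2 => hab ?_
      exact (h1.1 : f n x.1 = a).symm.trans h2.1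
    · exact fun a _ => (hm a).prod (hm a)
  have hstep : ∀ m n : NonposInt,
      (1 - α n) * d m (n.brickTime 0) ≤ d m (n.brickTime 2) := by
    intro m n
    have law : ∀ ψ : (NonposInt → ℝ) × (NonposInt → ℝ) → NonposInt → ℝ,
        MeasurePreserving ψ P π →
        P.map (fun x (k : Fin 3) => f (n.brickTime k) (ψ x)) =
          μ.map fun ω (k : Fin 3) => X (n.brickTime k) ω := by
      intro ψ hψ
      refine Pi.map_eq_of_forall_singleton (fun k => (mf' _).comp hψ.measurable)
        (fun k => mX _) fun a => ?_
      rw [← hlaw (fun k => n.brickTime k) a, ← hψ.measure_preimage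
        (MeasurableSet.iInter fun k =>
          mf' _ (measurableSet_singleton _)).nullMeasurableSet, Set.preimage_iInter]
      rfl
    have hfst : MeasurePreserving Prod.fst P π := measurePreserving_fst
    have key := (hbrick n).le_measureReal_inter (P := P)
      (G := fun k => coordField₂ (n.brickTime k))
      (fun i j hij => coordField₂_mono (n.brickTime_mono hij)) (fun k => coordField₂_le _)
      (Z' := fun k => f (n.brickTime k) ∘ Prod.fst) (Z'' := fun k => g m (n.brickTime k))
      (fun k => (mf _).comp (@measurable_fst _ _ (coordField _) (coordField _)))
      (fun k => (mf _).comp ((@measurable_fst _ _ (coordField _) (coordField _)).comp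
        (measurable_swapBelow_coordField₂ m _)))
      (law _ hfst) (law _ (hfst.comp (measurePreserving_swapBelow ν m)))
      (fun i j hij a b => (htr _ _ (n.brickTime_covBy hij) a b).prod_fst
        (coordField_le _) (coordField_le _))
      (fun i j hij a b => (htr _ _ (n.brickTime_covBy hij) a b).comp_swapBelow m
        (mf' _ (measurableSet_singleton a)) (mf' _ (measurableSet_singleton b)))
      (D := {x | x.1 ≠ x.2}) (fun _ hx => hx)
    exact key.trans (measureReal_mono Set.inter_subset_right)
  let β : ℕ → ℝ := fun k => α (NonposInt.neg k)
  have hneg : Function.Injective NonposInt.neg := fun a b h => by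
    have := congrArg Subtype.val h
    simpa [NonposInt.neg] using this
  obtain ⟨c, hc, hcN⟩ := exists_pos_le_prod_one_sub (β := β) (fun k => hα _)
    (hαsum.comp_injective hneg)
  have hchain : ∀ m N, (∏ k ∈ Finset.range N, (1 - β k)) * d m (NonposInt.neg N).double ≤
      d m (NonposInt.neg 0).double := by
    intro m N
    induction N with
    | zero => simp
    | succ N ih =>
      refine le_trans ?_ ih
      rw [Finset.prod_range_succ, mul_assoc, ← NonposInt.brickTime_neg_zero,
        ← NonposInt.brickTime_two]
      exact mul_le_mul_of_nonneg_left (hstep m (NonposInt.neg N))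
        (Finset.prod_nonneg fun k _ => sub_nonneg.2 (hα _).2.le)
  -- The factor `1/2` is the initial disagreement: two independent uniform variables on at least two
  -- points differ with probability at least `1/2`.
  have hlow : ∀ N, c / 2 ≤ d (NonposInt.neg N).double (NonposInt.neg 0).double := by
    intro N
    refine le_trans ?_ (hchain (NonposInt.neg N).double N)
    rw [← hstart]
    have hN : 1 < Fintype.card (F (NonposInt.neg N).double) := by
      have : Nonempty (F (NonposInt.neg N).double) := (μ.nonempty_of_neZero).map (X _)
      have h1 : 0 < Fintype.card (F (NonposInt.neg N).double) := Fintype.card_pos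
      have h2 := hF (NonposInt.neg N)
      omega
    have h3 : (Fintype.card (F (NonposInt.neg N).double) : ℝ)⁻¹ ≤ 2⁻¹ :=
      inv_anti₀ (by norm_num) (by exact_mod_cast hN)
    have h4 := hcN N
    rw [div_eq_mul_inv]
    exact mul_le_mul h4 (by linarith) (by norm_num) (hc.le.trans h4)
  have hsmall : ∀ᶠ m in atBot, d m (NonposInt.neg 0).double < c / 2 := by
    set n := (NonposInt.neg 0).double
    have hN : (0 : ℝ) < Fintype.card (F n) := by
      have : Nonempty (F n) := (μ.nonempty_of_neZero).map (X n)
      exact_mod_cast Fintype.card_pos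
    have h1 : ∀ a : F n, ∀ᶠ m in atBot, P (Prod.fst ⁻¹' (f n ⁻¹' {a}) \
        (Prod.fst ∘ swapBelow m) ⁻¹' (f n ⁻¹' {a})) <
          ENNReal.ofReal (c / 2 / Fintype.card (F n)) := fun a =>
      eventually_measure_preimage_diff_lt ν (mf' n (measurableSet_singleton a))
        (ENNReal.ofReal_pos.2 (by positivity))
    filter_upwards [eventually_all.2 h1] with m hm
    -- Disagreement means that some event `{f n = a}` holds for the first copy and fails for the
    -- second; each of the finitely many values gets an equal share of `c / 2`.
    have hsub : {x | f n x.1 ≠ g m n x} ⊆ ⋃ a ∈ (Finset.univ : Finset (F n)),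
        (Prod.fst ⁻¹' (f n ⁻¹' {a}) \ (Prod.fst ∘ swapBelow m) ⁻¹' (f n ⁻¹' {a})) := by
      intro x hx
      simp only [Set.mem_iUnion]
      exact ⟨f n x.1, Finset.mem_univ _, rfl, fun h => hx (Eq.symm h)⟩
    have hne : (Finset.univ : Finset (F n)).Nonempty :=
      Finset.card_pos.1 (by rw [Finset.card_univ]; exact_mod_cast hN)
    calc d m n ≤ ∑ a, P.real (Prod.fst ⁻¹' (f n ⁻¹' {a}) \
          (Prod.fst ∘ swapBelow m) ⁻¹' (f n ⁻¹' {a})) :=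
          (measureReal_mono hsub (measure_ne_top _ _)).trans (measureReal_biUnion_finset_le _ _)
      _ < ∑ _a : F n, c / 2 / Fintype.card (F n) := by
          refine Finset.sum_lt_sum_of_nonempty hne fun a _ => ?_
          exact (ENNReal.lt_ofReal_iff_toReal_lt (by finiteness)).1 (hm a)
      _ = c / 2 := by
          rw [Finset.sum_const, Finset.card_univ, nsmul_eq_mul]
          field_simp
  have htend : Tendsto (fun N : ℕ => (NonposInt.neg N).double) atTop atBot := by
    refine tendsto_atBot.2 fun b => ?_
    filter_upwards [eventually_ge_atTop b.1.natAbs] with N hN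
    refine Subtype.mk_le_mk.2 ?_
    change 2 * (-(N : ℤ)) ≤ b.1
    omega
  obtain ⟨N, hN⟩ := (htend.eventually hsmall).exists
  exact absurd hN (hlow N).not_gt

theorem tendsto_card_double {Ω : Type u} {mΩ : MeasurableSpace Ω} (μ : Measure Ω)
    [IsProbabilityMeasure μ] (F : NonposInt → Type w) [∀ n, Fintype (F n)]
    [∀ n, MeasurableSpace (F n)] [∀ n, MeasurableSingletonClass (F n)]
    (X : (n : NonposInt) → Ω → F n) (α : NonposInt → ℝ) (hαsum : Summable α)
    (hF : ∀ n : NonposInt, Fintype.card (F n.double) ≠ 1)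
    (hbrick : ∀ n : NonposInt, IsTsirelsonBrick μ (α n) fun k : Fin 3 => X (n.brickTime k)) :
    Tendsto (fun n : NonposInt => Fintype.card (F n.double)) atBot atTop := by
  have := NonposInt.noMinOrder
  have hpos : ∀ n, 0 < Fintype.card (F n) := fun n => by
    have : Nonempty (F n) := (μ.nonempty_of_neZero).map (X n)
    exact Fintype.card_pos
  have hle : ∀ n : NonposInt, (Fintype.card (F n.double) : ℝ)⁻¹ ≤ α n := by
    intro n
    rw [← n.brickTime_two]
    refine (hbrick n).inv_card_le ?_
    -- A brick starts at an even time, where the state space is not a singleton.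
    obtain ⟨m, hm⟩ := n.brickTime_zero
    have h1 := hpos m.double
    have h2 := hF m
    rw [hm]
    omega
  have hα0 : Tendsto α atBot (nhds 0) := hαsum.tendsto_cofinite_zero.mono_left atBot_le_cofinite
  have hinv : Tendsto (fun n : NonposInt => (Fintype.card (F n.double) : ℝ)⁻¹) atBot
      (nhdsWithin 0 (Set.Ioi 0)) :=
    tendsto_nhdsWithin_iff.2 ⟨squeeze_zero (fun n => by positivity) hle hα0,
      Eventually.of_forall fun n => Set.mem_Ioi.2 (inv_pos.2 (Nat.cast_pos.2 (hpos _)))⟩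
  have := hinv.inv_tendsto_nhdsGT_zero
  simpa [Function.comp_def, Pi.inv_def, tendsto_natCast_atTop_iff] using this

theorem mainTheorem6 {Ω : Type u} {mΩ : MeasurableSpace Ω} (μ : Measure Ω)
    [IsProbabilityMeasure μ] (F : NonposInt → Type w) [∀ n, Fintype (F n)]
    [∀ n, MeasurableSpace (F n)] [∀ n, MeasurableSingletonClass (F n)]
    (X : (n : NonposInt) → Ω → F n) (hX : ∀ n, IsUniformRV μ (X n))
    (α : NonposInt → ℝ) (hα : ∀ n, α n ∈ Set.Ioo (0 : ℝ) 1) (hαsum : Summable α)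
    (hF : ∀ n : NonposInt, Fintype.card (F n.double) ≠ 1)
    (hMarkov : IsMarkov μ X)
    (hbrick : ∀ n : NonposInt, IsTsirelsonBrick μ (α n) fun k : Fin 3 => X (n.brickTime k)) :
    ¬ IsStandard.{u, v} μ (naturalFiltration μ X) ∧
      (IsTrivialSigma μ (⨅ n, naturalFiltration μ X n) →
        Tendsto (fun n : NonposInt => Fintype.card (F n.double)) atBot atTop) :=
  ⟨not_isStandard_naturalFiltration μ F X hX α hα hαsum hF hMarkov hbrick,
    fun _ => tendsto_card_double μ F X α hαsum hF hbrick⟩
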